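/- Conventions. Let $\mathcal H^1$ be the one-dimensional Hausdorff measure in $\mathbb R^2$. For $r>0$, a unit vector $\nu$ and $x\in\mathbb R^2$, let $Q_{r,\nu}(x)$ be the open square of sidelength $2r$ centered at $x$ with sides parallel or perpendicular to $\nu$, and $Q_r(x):=Q_{r,\mathbf e_2}(x)$. Let $\sigma_{x,\rho}(y):=(y-x)/\rho$. An $\mathcal H^1$-measurable set $K\subset\mathbb R^2$ is rectifiable if $\mathcal H^1(K)<\infty$ and $\mathcal H^1$-almost all of $K$ is covered by countably many Lipschitz images of $\mathbb R$; a set is purely unrectifiable if it meets every one-dimensional Lipschitz graph (over any line) in an $\mathcal H^1$-null set. For an $\mathcal H^1$-measurable $K$ with $\mathcal H^1(K)<\infty$, the rectifiable part $K^r\subset K$ is the rectifiable set, unique up to $\mathcal H^1$-null sets, for which $K\setminus K^r$ is purely unrectifiable. A line $T$ through the origin is the approximate tangent line to $K$ at $x$ if $\limsup_{r\to0^+}\frac{\mathcal H^1(B_r(x)\cap K)}{2r}>0$ and, for every $\varepsilon>0$, $$\lim_{r\to0^+}\frac{\mathcal H^1(\{y\in B_r(x)\cap K:\ \mathrm{dist}(y-x,T)>\varepsilon|y-x|\})}{r}=0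 .$$ Sets $A_\rho$ converge to $A$ in the Kuratowski sense, $A_\rho\overset{K}{\to}A$, as $\rho\to0^+$, if $A$ is both the set of points all of whose neighbourhoods meet $A_\rho$ for all sufficiently small $\rho>0$ and the set of points all of whose neighbourhoods meet $A_\rho$ for arbitrarily small $\rho>0$. Weak-$*$ convergence of measures is tested against continuous functions with compact support. Proposition. Let $\Gamma\subset\mathbb R^2$ be a Borel set with $\mathcal H^1(\Gamma)<+\infty$ such that, for some $r_0,c,C>0$ and for all $x\in\Gamma$, $$c\le\frac{\mathcal H^1(Q_r(x)\cap\Gamma)}{2r}\le C,\qquad r\in(0,r_0).$$ ($\Gamma$ need be neither connected nor rectifiable.) Then for $\mathcal H^1$-a.e. $x\in\Gamma^r$ there is exactly one approximate tangent line $T_x$ to $\Gamma$ at $x$, and, with $\nu$ a unit normal to $T_x$, for every $R>0$, $$\overline{Q_{R,\nu}(0)}\cap\sigma_{x,\rho}(\Gamma)\overset{K}{\to}\overline{Q_{R,\nu}(0)}\cap T_x\qquad\text{(1)}$$ and $$\mathcal H^1\llcorner\sigma_{x,\rho}(\Gamma)\overset{*}{\rightharpoonup}\mathcal H^1\llcorner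 T_x\qquad\text{(2)}$$ as $\rho\to0^+$. Moreover, for every $\mathcal H^1$-measurable $\Gamma'\subset\Gamma$ and $\mathcal H^1$-a.e. $x\in(\Gamma')^r$ there is exactly one approximate tangent line $T_x$ to $\Gamma'$ at $x$, it is also an approximate tangent line to $\Gamma$ at $x$, and (1) and (2) hold with $\Gamma'$ in place of $\Gamma$. -/

import Mathlib

open MeasureTheory Filter Topology

namespace PlanarBlowUp

noncomputable section

/-- The Euclidean plane. -/
abbrev Plane : Type := EuclideanSpace ℝ (Fin 2)

/-- The rotation of `v` by a right angle. -/
def perp (v : Plane) : Plane := !₂[-(v 1), v 0]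

/-- The second standard basis vector. -/
def e₂ : Plane := !₂[0, 1]

/-- For a unit vector `ν`, the open square of sidelength `2 * r` centered at `x` whose sides are
parallel or perpendicular to `ν`. -/
def square (r : ℝ) (ν x : Plane) : Set Plane :=
  {y | |inner ℝ ν (y - x)| < r ∧ |inner ℝ (perp ν) (y - x)| < r}

/-- The blow-up map `y ↦ (y - x) / ρ`. -/
def blowUp (x : Plane) (ρ : ℝ) (y : Plane) : Plane := ρ⁻¹ • (y - x)

/-- A set is `H¹`-rectifiable if it is `H¹`-measurable, has finite `H¹` measure and is covered, up
to an `H¹`-null set, by countably many Lipschitz images of the real line. -/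
def IsRectifiable (K : Set Plane) : Prop :=
  NullMeasurableSet K μH[1] ∧ μH[1] K < ⊤ ∧
    ∃ f : ℕ → ℝ → Plane, (∀ i, ∃ L, LipschitzWith L (f i)) ∧
      μH[1] (K \ ⋃ i, Set.range (f i)) = 0

/-- The graph of `g : ℝ → ℝ` over the line spanned by the unit vector `τ`. -/
def lineGraph (τ : Plane) (g : ℝ → ℝ) : Set Plane :=
  Set.range fun s : ℝ => s • τ + g s • perp τ

/-- A set is purely unrectifiable if it meets every one-dimensional Lipschitz graph (over any
line) in an `H¹`-null set. -/
def IsPurelyUnrectifiable (K : Set Plane) : Prop :=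
  ∀ τ : Plane, ‖τ‖ = 1 → ∀ g : ℝ → ℝ, (∃ L, LipschitzWith L g) →
    μH[1] (K ∩ lineGraph τ g) = 0

/-- `Kr` is a rectifiable part of `K`: it is a rectifiable subset of `K` whose complement in `K` is
purely unrectifiable. Such a set is unique up to `H¹`-null sets. -/
def IsRectifiablePart (K Kr : Set Plane) : Prop :=
  Kr ⊆ K ∧ IsRectifiable Kr ∧ IsPurelyUnrectifiable (K \ Kr)

/-- The upper one-dimensional density of `K` at `x`. -/
def upperDensity (K : Set Plane) (x : Plane) : ENNReal :=
  limsup (fun r : ℝ => μH[1] (Metric.ball x r ∩ K) / ENNReal.ofReal (2 * r)) (𝓝[>] 0)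

/-- The line `T` through the origin is the (direction of the) approximate tangent line to `K` at
`x`: the upper density of `K` at `x` is positive and, for every double cone around `x + T`, the part
of `K` inside the ball of radius `r` about `x` and outside the cone has measure `o(r)`. -/
def IsApproxTangentLine (K : Set Plane) (x : Plane) (T : Submodule ℝ Plane) : Prop :=
  Module.finrank ℝ T = 1 ∧ 0 < upperDensity K x ∧
    ∀ ε : ℝ, 0 < ε →
      Tendsto (fun r : ℝ =>
        μH[1] {y ∈ Metric.ball x r ∩ K | ε * ‖y - x‖ < Metric.infDist (y - x) (T : Set Plane)}
          / ENNReal.ofReal r) (𝓝[>] 0) (𝓝 0)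

/-- The lower Kuratowski limit of a family of sets along a filter. -/
def kuratowskiLiminf {ι X : Type*} [TopologicalSpace X] (A : ι → Set X) (l : Filter ι) : Set X :=
  {y | ∀ U ∈ 𝓝 y, ∀ᶠ i in l, (U ∩ A i).Nonempty}

/-- The upper Kuratowski limit of a family of sets along a filter. -/
def kuratowskiLimsup {ι X : Type*} [TopologicalSpace X] (A : ι → Set X) (l : Filter ι) : Set X :=
  {y | ∀ U ∈ 𝓝 y, ∃ᶠ i in l, (U ∩ A i).Nonempty}

/-- Kuratowski convergence of a family of sets along a filter. -/
def KuratowskiTendsto {ι X : Type*} [TopologicalSpace X] (A : ι → Set X) (l : Filter ι)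
    (B : Set X) : Prop :=
  kuratowskiLiminf A l = B ∧ kuratowskiLimsup A l = B

/-- Weak-* convergence of (locally finite) measures on the plane, tested against continuous
functions with compact support. -/
def WeakStarTendsto {ι : Type*} (μ : ι → Measure Plane) (l : Filter ι) (ν : Measure Plane) : Prop :=
  ∀ f : Plane → ℝ, Continuous f → HasCompactSupport f →
    Tendsto (fun i => ∫ y, f y ∂(μ i)) l (𝓝 (∫ y, f y ∂ν))

/-- As `ρ → 0⁺`, the blow-ups of `K` at `x`, intersected with the closed squares centered at the
origin with a side orthogonal to `T`, converge to the intersection of the square with the line `T`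
in the sense of Kuratowski. -/
def BlowUpsTendstoInSquares (K : Set Plane) (x : Plane) (T : Submodule ℝ Plane) : Prop :=
  ∀ ν : Plane, ‖ν‖ = 1 → ν ∈ Tᗮ → ∀ R : ℝ, 0 < R →
    KuratowskiTendsto (fun ρ : ℝ => closure (square R ν 0) ∩ blowUp x ρ '' K) (𝓝[>] 0)
      (closure (square R ν 0) ∩ (T : Set Plane))

/-- As `ρ → 0⁺`, the measures `H¹` restricted to the blow-ups of `K` at `x` converge weakly-* to
`H¹` restricted to the line `T`. -/
def BlowUpMeasuresTendsto (K : Set Plane) (x : Plane) (T : Submodule ℝ Plane) : Prop :=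
  WeakStarTendsto (fun ρ : ℝ => (μH[1] : Measure Plane).restrict (blowUp x ρ '' K)) (𝓝[>] 0)
    ((μH[1] : Measure Plane).restrict (T : Set Plane))

end

end PlanarBlowUp

open PlanarBlowUp

/-! A Lipschitz curve is almost linear near almost every parameter. Hence, for each `ε`, a
rectifiable set is covered up to a null set by countably many closed sets whose chords all have
slope at most `ε` over a fixed line. On such a flat set, projection to its line is 1-Lipschitz with
a `(1 + ε)`-Lipschitz inverse, so its length almost equals that of its shadow.

Let `W` be the part of the rectifiable set in one flat piece. At almost every `x` in `W`, two
density theorems apply: `Γ \ W` has measure `o(r)` in the ball of radius `r` about `x`, the upper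
density bound turning a relative density into an absolute one, and the shadow of `W` has Lebesgue
density 1 at the shadow of `x`. This is `IsFlatApproxAt`. Taking `ε = 1/(k+1)` and a limit of
directions on the compact unit circle gives `HasFlatDirectionAt`.

The limit direction spans the tangent line. It is unique because two distinct lines have narrow
cones meeting only at the origin (`exists_cones_disjoint`). Weak-* convergence follows from the
one-scale estimate `abs_setIntegral_sub_integral_line_le`. It forces the blow-ups to meet every
neighbourhood of a point of the line. Conversely, a blow-up point far from the line would, by the
lower density bound on `Γ`, carry mass of order `r` outside a cone. For a subset the cone condition
is used on `Γ` itself, the only set with a lower bound. -/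

namespace PlanarBlowUp

/-! ### Flat pieces of Lipschitz curves -/

/-- A set is `ε`-flat in the direction `τ` if all its chords have slope at most `ε` over the line
spanned by `τ`. -/
def IsFlat (ε : ℝ) (τ : Plane) (S : Set Plane) : Prop :=
  ∀ y ∈ S, ∀ z ∈ S,
    ‖(y - z) - (inner ℝ τ (y - z) : ℝ) • τ‖ ≤ ε * |inner ℝ τ (y - z)|

theorem IsFlat.mono {ε : ℝ} {τ : Plane} {S S' : Set Plane} (h : IsFlat ε τ S) (hs : S' ⊆ S) :
    IsFlat ε τ S' := fun y hy z hz => h y (hs hy) z (hs hz)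

theorem isClosed_setOf_slope_le (ε : ℝ) (τ : Plane) :
    IsClosed {v : Plane | ‖v - (inner ℝ τ v : ℝ) • τ‖ ≤ ε * |inner ℝ τ v|} :=
  isClosed_le (by fun_prop) (by fun_prop)

theorem isFlat_closure {ε : ℝ} {τ : Plane} {S : Set Plane} (h : IsFlat ε τ S) :
    IsFlat ε τ (closure S) := by
  intro y hy z hz
  have hsub : ∀ y ∈ S, ∀ z ∈ S,
      y - z ∈ {v : Plane | ‖v - (inner ℝ τ v : ℝ) • τ‖ ≤ ε * |inner ℝ τ v|} := h
  have := map_mem_closure₂ continuous_sub hy hz hsub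
  rwa [(isClosed_setOf_slope_le ε τ).closure_eq] at this

/-- With `a = ‖A 1‖`, the linearization error is at most `ε/4 * a|t - u|`. The normal part of a
chord is at most twice the error, and its tangential part is at least `a|t - u| / 2`. -/
theorem _root_.ApproximatesLinearOn.isFlat_image {f : ℝ → Plane} {A : ℝ →L[ℝ] Plane} {s : Set ℝ}
    {c : NNReal} {ε : ℝ} (hf : ApproximatesLinearOn f A s c) (hA : A 1 ≠ 0) (hε : 0 < ε)
    (hε1 : ε ≤ 1) (hc : (c : ℝ) ≤ ε / 4 * ‖A 1‖) :
    IsFlat ε (‖A 1‖⁻¹ • A 1) (f '' s) := by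
  rintro _ ⟨t, ht, rfl⟩ _ ⟨u, hu, rfl⟩
  set a := ‖A 1‖ with ha
  have hapos : 0 < a := norm_pos_iff.2 hA
  set τ := a⁻¹ • A 1 with hτ
  have hτn : ‖τ‖ = 1 := by
    rw [hτ, norm_smul, norm_inv, Real.norm_of_nonneg hapos.le, ← ha, inv_mul_cancel₀ hapos.ne']
  have hA' : A (t - u) = ((t - u) * a) • τ := by
    rw [hτ, smul_smul, mul_assoc, mul_inv_cancel₀ hapos.ne', mul_one, ← map_smul, smul_eq_mul,
      mul_one]
  set e := f t - f u - A (t - u) with he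
  have hv : f t - f u = ((t - u) * a) • τ + e := by rw [he, hA']; abel
  have hen : ‖e‖ ≤ ε / 4 * (a * |t - u|) := by
    refine (hf t ht u hu).trans ?_
    rw [Real.norm_eq_abs]
    nlinarith [abs_nonneg (t - u)]
  have hin : |inner ℝ τ e| ≤ ‖e‖ := by
    simpa [hτn] using abs_real_inner_le_norm τ e
  have hτe : inner ℝ τ (f t - f u) = (t - u) * a + inner ℝ τ e := by
    rw [hv, inner_add_right, real_inner_smul_right, real_inner_self_eq_norm_sq, hτn]
    ring
  have hrest : f t - f u - (inner ℝ τ (f t - f u) : ℝ) • τ = e - (inner ℝ τ e : ℝ) • τ := by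
    rw [hτe, hv, add_smul]; abel
  rw [hrest, hτe]
  have h1 : ‖e - (inner ℝ τ e : ℝ) • τ‖ ≤ 2 * ‖e‖ := by
    refine (norm_sub_le _ _).trans ?_
    rw [norm_smul, hτn, Real.norm_eq_abs]
    linarith
  have h2 : a * |t - u| - ‖e‖ ≤ |(t - u) * a + inner ℝ τ e| := by
    have := abs_sub_abs_le_abs_add ((t - u) * a) (inner ℝ τ e)
    rw [abs_mul, abs_of_pos hapos] at this
    linarith
  have h3 : 0 ≤ a * |t - u| := by positivity
  have h4 : ε * (a * |t - u|) ≤ a * |t - u| := mul_le_of_le_one_left h3 hε1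
  have h5 : a * |t - u| / 2 ≤ |(t - u) * a + inner ℝ τ e| := by linarith
  have h6 := mul_le_mul_of_nonneg_left h5 hε.le
  linarith

/-- A Sard argument: for every `δ > 0` the set splits into countably many pieces on which `f` is
`δ`-Lipschitz, so bounded portions have images of measure at most `δ` times their length. -/
theorem hausdorffMeasure_image_eq_zero_of_deriv_eq_zero {f : ℝ → Plane} {s : Set ℝ}
    (hf : ∀ t ∈ s, HasFDerivWithinAt f (0 : ℝ →L[ℝ] Plane) s t) : μH[1] (f '' s) = 0 := by
  have key : ∀ s : Set ℝ, (∀ t ∈ s, HasFDerivWithinAt f (0 : ℝ →L[ℝ] Plane) s t) →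
      volume s < ⊤ → ∀ δ : NNReal, δ ≠ 0 → μH[1] (f '' s) ≤ δ * volume s := by
    intro s hf hs δ hδ
    obtain ⟨t, A, hdis, hmeas, hcov, happ, hA⟩ :=
      exists_partition_approximatesLinearOn_of_hasFDerivWithinAt f s (fun _ => 0) hf
        (fun _ => δ) (fun _ => hδ)
    rcases s.eq_empty_or_nonempty with rfl | hne
    · simp
    have hlip : ∀ n, LipschitzOnWith δ f (s ∩ t n) := by
      intro n
      obtain ⟨_, _, hA0⟩ := hA hne n
      refine LipschitzOnWith.of_dist_le_mul fun x hx y hy => ?_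
      have := happ n x hx y hy
      rw [hA0] at this
      simpa [dist_eq_norm] using this
    calc μH[1] (f '' s) = μH[1] (⋃ n, f '' (s ∩ t n)) := by
          rw [← Set.image_iUnion, ← Set.inter_iUnion, Set.inter_eq_left.2 hcov]
      _ ≤ ∑' n, μH[1] (f '' (s ∩ t n)) := measure_iUnion_le _
      _ ≤ ∑' n, δ * volume (s ∩ t n) := by
          refine ENNReal.tsum_le_tsum fun n => ?_
          simpa [hausdorffMeasure_real] using (hlip n).hausdorffMeasure_image_le zero_le_one
      _ = δ * ∑' n, volume.restrict s (t n) := by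
          rw [ENNReal.tsum_mul_left]
          congr 2; ext n
          rw [Measure.restrict_apply (hmeas n), Set.inter_comm]
      _ = δ * volume.restrict s (⋃ n, t n) := by rw [measure_iUnion hdis hmeas]
      _ ≤ δ * volume s := by
          refine mul_le_mul_right ?_ _
          rw [← Measure.restrict_apply_univ s]
          exact measure_mono (Set.subset_univ _)
  have hN : s = ⋃ n : ℕ, s ∩ Metric.closedBall 0 n := by
    rw [← Set.inter_iUnion, Metric.iUnion_closedBall_nat, Set.inter_univ]
  rw [hN, Set.image_iUnion, measure_iUnion_null_iff]
  intro n
  have hfin : volume (s ∩ Metric.closedBall (0 : ℝ) n) < ⊤ :=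
    (measure_mono Set.inter_subset_right).trans_lt measure_closedBall_lt_top
  have hk := key _ (fun t ht => (hf t ht.1).mono Set.inter_subset_left) hfin
  by_contra hne
  set V := volume (s ∩ Metric.closedBall (0 : ℝ) n) with hV
  set H := μH[1] (f '' (s ∩ Metric.closedBall (0 : ℝ) n))
  have hlim : Tendsto (fun δ : NNReal => (δ : ENNReal) * V) (𝓝[>] 0) (𝓝 0) := by
    have : Tendsto (fun δ : NNReal => (δ : ENNReal) * V) (𝓝 0) (𝓝 (((0 : NNReal) : ENNReal) * V)) :=
      ENNReal.Tendsto.mul_const (ENNReal.tendsto_coe.2 tendsto_id) (Or.inr hfin.ne)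
    simpa using this.mono_left nhdsWithin_le_nhds
  have : H ≤ 0 := ge_of_tendsto hlim (by
    filter_upwards [self_mem_nhdsWithin] with δ hδ using hk δ (ne_of_gt hδ))
  exact hne (le_antisymm this (by simp))

/-- Almost all of a Lipschitz curve is covered by countably many closed flat sets. -/
theorem exists_closed_flat_cover_range {f : ℝ → Plane} {L : NNReal} (hf : LipschitzWith L f)
    {ε : ℝ} (hε : 0 < ε) (hε1 : ε ≤ 1) :
    ∃ S : ℕ → Set Plane, (∀ n, IsClosed (S n) ∧ ∃ τ : Plane, ‖τ‖ = 1 ∧ IsFlat ε τ (S n)) ∧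
      μH[1] (Set.range f \ ⋃ n, S n) = 0 := by
  set N : Set ℝ := {t | ¬ DifferentiableAt ℝ f t} with hNdef
  set Z : Set ℝ := {t | DifferentiableAt ℝ f t ∧ fderiv ℝ f t = 0} with hZdef
  set D : Set ℝ := {t | DifferentiableAt ℝ f t ∧ fderiv ℝ f t ≠ 0} with hDdef
  have hN : μH[1] (f '' N) = 0 := by
    have h0 : volume N = 0 := hf.ae_differentiableAt_real
    have := hf.hausdorffMeasure_image_le zero_le_one N
    rw [hausdorffMeasure_real, h0, mul_zero] at this
    exact le_antisymm this (by simp)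
  have hZ : μH[1] (f '' Z) = 0 := by
    refine hausdorffMeasure_image_eq_zero_of_deriv_eq_zero fun t ht => ?_
    have := ht.1.hasFDerivAt.hasFDerivWithinAt (s := Z)
    rwa [ht.2] at this
  have hone : ∀ A : ℝ →L[ℝ] Plane, A 1 = 0 ↔ A = 0 := fun A =>
    ⟨fun h => by ext1; simpa using h, fun h => by simp [h]⟩
  obtain ⟨t, A, -, hcov, happ, hA⟩ :=
    exists_closed_cover_approximatesLinearOn_of_hasFDerivWithinAt f D (fderiv ℝ f)
      (fun t ht => ht.1.hasFDerivAt.hasFDerivWithinAt)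
      -- The value 1 only keeps the tolerance positive; the maps selected below are derivatives at
      -- points of `D`, where `A 1 ≠ 0`.
      (fun A => if A 1 = 0 then (1 : NNReal) else (ε / 4 * ‖A 1‖).toNNReal) (by
        intro A
        split_ifs with h
        · exact one_ne_zero
        · have : 0 < ε / 4 * ‖A 1‖ := by have := norm_pos_iff.2 h; positivity
          exact (Real.toNNReal_pos.2 this).ne')
  obtain ⟨v, hv⟩ : ∃ v : Plane, ‖v‖ = 1 := ⟨EuclideanSpace.single 0 1, by simp⟩
  refine ⟨fun n => closure (f '' (D ∩ t n)), fun n => ⟨isClosed_closure, ?_⟩, ?_⟩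
  · rcases D.eq_empty_or_nonempty with hD | hD
    · exact ⟨v, hv, by simp [hD, IsFlat]⟩
    obtain ⟨y, hy, hAy⟩ := hA hD n
    have hA1 : A n 1 ≠ 0 := fun h => hy.2 (by rw [← hAy]; exact (hone _).1 h)
    refine ⟨‖A n 1‖⁻¹ • A n 1, ?_, ?_⟩
    · rw [norm_smul, norm_inv, norm_norm, inv_mul_cancel₀ (norm_ne_zero_iff.2 hA1)]
    · refine isFlat_closure ((happ n).isFlat_image hA1 hε hε1 ?_)
      rw [if_neg hA1, Real.coe_toNNReal _ (by positivity)]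
  · refine measure_mono_null ?_ (measure_union_null hN hZ)
    rintro _ ⟨⟨u, rfl⟩, hu⟩
    by_cases hd : DifferentiableAt ℝ f u
    · by_cases h0 : fderiv ℝ f u = 0
      · exact Or.inr ⟨u, ⟨hd, h0⟩, rfl⟩
      · obtain ⟨n, hn⟩ := Set.mem_iUnion.1 (hcov ⟨hd, h0⟩)
        have hmem : u ∈ D ∩ t n := ⟨⟨hd, h0⟩, hn⟩
        exact absurd (Set.mem_iUnion.2 ⟨n, subset_closure (Set.mem_image_of_mem f hmem)⟩) hu
    · exact Or.inl ⟨u, hd, rfl⟩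

theorem IsRectifiable.exists_closed_flat_cover {K : Set Plane} (hK : IsRectifiable K) {ε : ℝ}
    (hε : 0 < ε) (hε1 : ε ≤ 1) :
    ∃ S : ℕ × ℕ → Set Plane,
      (∀ n, IsClosed (S n) ∧ ∃ τ : Plane, ‖τ‖ = 1 ∧ IsFlat ε τ (S n)) ∧
      μH[1] (K \ ⋃ n, S n) = 0 := by
  obtain ⟨-, -, f, hf, hcov⟩ := hK
  choose L hL using hf
  choose S hS hS0 using fun i => exists_closed_flat_cover_range (hL i) hε hε1
  refine ⟨fun p => S p.1 p.2, fun p => hS p.1 p.2, ?_⟩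
  refine measure_mono_null ?_ (measure_union_null hcov (measure_iUnion_null hS0))
  intro x hx
  by_cases h : x ∈ ⋃ i, Set.range (f i)
  · obtain ⟨i, hi⟩ := Set.mem_iUnion.1 h
    refine Or.inr (Set.mem_iUnion.2 ⟨i, hi, fun hx' => hx.2 ?_⟩)
    obtain ⟨n, hn⟩ := Set.mem_iUnion.1 hx'
    exact Set.mem_iUnion.2 ⟨(i, n), hn⟩
  · exact Or.inl ⟨hx.1, h⟩

/-! ### Comparison of a flat set with a line -/

/-- The difference `ν - μ` is a positive measure of mass at most `η`. -/
theorem abs_integral_sub_integral_le_of_le {X : Type*} [MeasurableSpace X] {μ ν : Measure X}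
    [IsFiniteMeasure ν] (h : μ ≤ ν) {f : X → ℝ} (hf : StronglyMeasurable f) {M η : ℝ}
    (hM : ∀ x, |f x| ≤ M) (hM0 : 0 ≤ M) (hη : 0 ≤ η)
    (hmass : ν Set.univ ≤ μ Set.univ + ENNReal.ofReal η) :
    |∫ x, f x ∂ν - ∫ x, f x ∂μ| ≤ M * η := by
  have : IsFiniteMeasure μ := isFiniteMeasure_of_le ν h
  have hsum := Measure.sub_add_cancel_of_le h
  have hint : ∀ (m : Measure X) [IsFiniteMeasure m], Integrable f m := fun m _ =>
    Integrable.of_bound (C := M) hf.aestronglyMeasurable (Eventually.of_forall hM)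
  have hI : ∫ x, f x ∂ν = ∫ x, f x ∂(ν - μ) + ∫ x, f x ∂μ := by
    conv_lhs => rw [← hsum]
    exact integral_add_measure (hint _) (hint _)
  have hle : (ν - μ) Set.univ ≤ ENNReal.ofReal η := by
    have h1 : (ν - μ) Set.univ + μ Set.univ ≤ ENNReal.ofReal η + μ Set.univ := by
      rw [← Measure.add_apply, hsum, add_comm]
      exact hmass
    exact (ENNReal.add_le_add_iff_right (measure_ne_top μ _)).1 h1
  rw [hI, add_sub_cancel_right]
  refine (norm_integral_le_of_norm_le_const (f := f) (C := M) (Eventually.of_forall hM)).trans ?_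
  exact mul_le_mul_of_nonneg_left (ENNReal.toReal_le_of_le_ofReal hη hle) hM0

theorem lipschitzWith_inner {τ : Plane} (hτ : ‖τ‖ = 1) :
    LipschitzWith 1 (inner ℝ τ : Plane → ℝ) := by
  refine LipschitzWith.of_dist_le_mul fun y z => ?_
  rw [Real.dist_eq, ← inner_sub_right, dist_eq_norm]
  simpa [hτ] using abs_real_inner_le_norm τ (y - z)

theorem volume_inner_image_le {τ : Plane} (hτ : ‖τ‖ = 1) (X : Set Plane) :
    volume (inner ℝ τ '' X) ≤ μH[1] X := by
  simpa [hausdorffMeasure_real] using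
    (lipschitzWith_inner hτ).hausdorffMeasure_image_le zero_le_one X

theorem norm_le_of_slope_le {ε : ℝ} {τ v : Plane} (hτ : ‖τ‖ = 1)
    (hv : ‖v - (inner ℝ τ v : ℝ) • τ‖ ≤ ε * |inner ℝ τ v|) :
    ‖v‖ ≤ (1 + ε) * |inner ℝ τ v| := by
  have := norm_add_le (v - (inner ℝ τ v : ℝ) • τ) ((inner ℝ τ v : ℝ) • τ)
  rw [sub_add_cancel, norm_smul, hτ, Real.norm_eq_abs] at this
  linarith

/-- The slope bound makes the projection injective on `X`, with a `(1 + ε)`-Lipschitz inverse. -/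
theorem IsFlat.hausdorffMeasure_le {ε : ℝ} {τ : Plane} {X : Set Plane} (h : IsFlat ε τ X)
    (hτ : ‖τ‖ = 1) (hε : 0 ≤ ε) :
    μH[1] X ≤ ENNReal.ofReal (1 + ε) * volume (inner ℝ τ '' X) := by
  have hdist : ∀ y ∈ X, ∀ z ∈ X, dist y z ≤ (1 + ε) * dist (inner ℝ τ y : ℝ) (inner ℝ τ z) := by
    intro y hy z hz
    rw [dist_eq_norm, Real.dist_eq, ← inner_sub_right]
    exact norm_le_of_slope_le hτ (h y hy z hz)
  have hinj : Set.InjOn (inner ℝ τ : Plane → ℝ) X := by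
    intro y hy z hz hyz
    have := hdist y hy z hz
    rw [hyz, dist_self, mul_zero] at this
    exact dist_le_zero.1 this
  have hinv := hinj.leftInvOn_invFunOn
  set g := Function.invFunOn (inner ℝ τ : Plane → ℝ) X
  have hlip : LipschitzOnWith (Real.toNNReal (1 + ε)) g (inner ℝ τ '' X) := by
    refine LipschitzOnWith.of_dist_le_mul ?_
    rintro _ ⟨y, hy, rfl⟩ _ ⟨z, hz, rfl⟩
    rw [hinv hy, hinv hz, Real.coe_toNNReal _ (by positivity)]
    exact hdist y hy z hz
  have := hlip.hausdorffMeasure_image_le zero_le_one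
  rwa [hinv.image_image, hausdorffMeasure_real, ENNReal.rpow_one] at this

theorem setIntegral_restrict_eq {X : Type*} [MeasurableSpace X] {μ : Measure X} {f : X → ℝ}
    {B : Set X} (hf : ∀ x, x ∉ B → f x = 0) : ∫ x, f x ∂(μ.restrict B) = ∫ x, f x ∂μ :=
  setIntegral_eq_integral_of_forall_compl_eq_zero hf

theorem norm_smul_unit {τ : Plane} (hτ : ‖τ‖ = 1) (s : ℝ) : ‖s • τ‖ = |s| := by
  rw [norm_smul, hτ, mul_one, Real.norm_eq_abs]

/-- Comparison, at a fixed scale, of a set that is mostly flat near the origin with a line. -/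
theorem abs_setIntegral_sub_integral_line_le {K W : Set Plane} {τ : Plane} {ε R η ω M : ℝ}
    {f : Plane → ℝ} (hWK : W ⊆ K) (h0 : (0 : Plane) ∈ W) (hτ : ‖τ‖ = 1) (hε : 0 ≤ ε)
    (hε1 : ε ≤ 1) (hR : 0 ≤ R) (hη : 0 ≤ η) (hω0 : 0 ≤ ω) (hflat : IsFlat ε τ W) (hK : μH[1] K < ⊤)
    (hrest : μH[1] ((K \ W) ∩ Metric.closedBall 0 R) ≤ ENNReal.ofReal η)
    (hproj : ENNReal.ofReal (2 * R) ≤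
      volume (inner ℝ τ '' W ∩ Metric.closedBall 0 R) + ENNReal.ofReal η)
    (hf : Continuous f) (hfR : ∀ y, R < ‖y‖ → f y = 0) (hM : ∀ y, |f y| ≤ M)
    (hω : ∀ y z, ‖y - z‖ ≤ R * ε → |f y - f z| ≤ ω) :
    |∫ y, f y ∂((μH[1] : Measure Plane).restrict K) - ∫ s : ℝ, f (s • τ)| ≤
      M * (2 * η + 2 * R * ε) + 4 * R * ω := by
  have hM0 : 0 ≤ M := (abs_nonneg _).trans (hM 0)
  set H : Measure Plane := μH[1] with hH
  have hWfin : H W < ⊤ := (measure_mono hWK).trans_lt hK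
  have : IsFiniteMeasure (H.restrict K) := ⟨by rwa [Measure.restrict_apply_univ]⟩
  have : IsFiniteMeasure (H.restrict W) := ⟨by rwa [Measure.restrict_apply_univ]⟩
  set B : Set Plane := Metric.closedBall 0 R with hB
  have hBm : MeasurableSet B := Metric.isClosed_closedBall.measurableSet
  set J : Set ℝ := Metric.closedBall 0 R with hJ
  have hJm : MeasurableSet J := Metric.isClosed_closedBall.measurableSet
  have hcont : Continuous (inner ℝ τ : Plane → ℝ) := (lipschitzWith_inner hτ).continuous
  set P : Set Plane := inner ℝ τ ⁻¹' J with hP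
  have hPm : MeasurableSet P := hcont.measurable hJm
  have hfB : ∀ y, y ∉ B → f y = 0 := fun y hy => hfR y (by simpa [hB] using hy)
  have hfP : ∀ y, y ∉ P → f y = 0 := fun y hy => hfR y (by
    have h1 : R < |inner ℝ τ y| := by simpa [hP, hJ] using hy
    have h2 := abs_real_inner_le_norm τ y
    rw [hτ, one_mul] at h2
    linarith)
  have hfJ : ∀ s : ℝ, s ∉ J → f (s • τ) = 0 := fun s hs => hfR _ (by
    rw [norm_smul_unit hτ]; simpa [hJ] using hs)
  have hfm := hf.stronglyMeasurable
  have hgm : StronglyMeasurable fun s : ℝ => f (s • τ) :=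
    (hf.comp (continuous_id.smul continuous_const)).stronglyMeasurable
  -- from `K` to `W`
  have step1 : |∫ y, f y ∂(H.restrict K) - ∫ y, f y ∂(H.restrict W)| ≤ M * η := by
    rw [← setIntegral_restrict_eq (μ := H.restrict K) hfB,
      ← setIntegral_restrict_eq (μ := H.restrict W) hfB]
    refine abs_integral_sub_integral_le_of_le
      (Measure.restrict_mono_measure (Measure.restrict_mono_set H hWK) B) hfm hM hM0 hη ?_
    rw [Measure.restrict_apply_univ, Measure.restrict_apply_univ, Measure.restrict_apply hBm,
      Measure.restrict_apply hBm]
    refine (measure_mono (t := B ∩ W ∪ (K \ W) ∩ B) ?_).trans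
      ((measure_union_le _ _).trans (add_le_add_right hrest _))
    intro y hy
    by_cases hyW : y ∈ W
    · exact Or.inl ⟨hy.1, hyW⟩
    · exact Or.inr ⟨⟨hy.2, hyW⟩, hy.1⟩
  -- the image measures on the line
  set lam : Measure ℝ := (volume.restrict (inner ℝ τ '' W)).restrict J with hlam
  set β : Measure Plane := (H.restrict W).restrict P with hβ
  have hβapply : ∀ A : Set ℝ, MeasurableSet A →
      β (inner ℝ τ ⁻¹' A) = H (W ∩ inner ℝ τ ⁻¹' (A ∩ J)) := by
    intro A hA
    have hA' : MeasurableSet ((inner ℝ τ : Plane → ℝ) ⁻¹' A) := hcont.measurable hA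
    rw [hβ, Measure.restrict_apply hA', Measure.restrict_apply (hA'.inter hPm), Set.inter_comm,
      ← Set.preimage_inter]
  have hlapply : ∀ A : Set ℝ, MeasurableSet A →
      lam A = volume (inner ℝ τ '' (W ∩ inner ℝ τ ⁻¹' (A ∩ J))) := by
    intro A hA
    rw [hlam, Measure.restrict_apply hA, Measure.restrict_apply (hA.inter hJm),
      Set.image_inter_preimage, Set.inter_comm]
  -- Projection does not increase length, so the shadow measure is below the pushforward; flatness
  -- bounds the excess mass by `2 * R * ε`.
  have hlb : lam ≤ β.map (inner ℝ τ) := by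
    refine Measure.le_iff.2 fun A hA => ?_
    rw [Measure.map_apply hcont.measurable hA, hβapply A hA, hlapply A hA]
    exact volume_inner_image_le hτ _
  have hlvol : lam ≤ volume.restrict J :=
    Measure.restrict_mono_measure Measure.restrict_le_self J
  have hJvol : volume J = ENNReal.ofReal (2 * R) := by rw [hJ, Real.volume_closedBall]
  have : IsFiniteMeasure ((volume : Measure ℝ).restrict J) :=
    ⟨by rw [Measure.restrict_apply_univ, hJvol]; exact ENNReal.ofReal_lt_top⟩
  have hlu : lam Set.univ ≤ ENNReal.ofReal (2 * R) := by
    refine (hlvol Set.univ).trans_eq ?_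
    rw [Measure.restrict_apply_univ, hJvol]
  have hβu : (β.map (inner ℝ τ)) Set.univ ≤ ENNReal.ofReal (1 + ε) * lam Set.univ := by
    rw [Measure.map_apply hcont.measurable MeasurableSet.univ, hβapply _ MeasurableSet.univ,
      hlapply _ MeasurableSet.univ]
    exact (hflat.mono Set.inter_subset_left).hausdorffMeasure_le hτ hε
  have hβu' : (β.map (inner ℝ τ)) Set.univ ≤ lam Set.univ + ENNReal.ofReal (2 * R * ε) := by
    refine hβu.trans ?_
    rw [ENNReal.ofReal_add zero_le_one hε, add_mul, ENNReal.ofReal_one, one_mul,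
      ENNReal.ofReal_mul (by positivity), mul_comm (ENNReal.ofReal ε)]
    gcongr
  have hβmass : β.real Set.univ ≤ 4 * R := by
    refine ENNReal.toReal_le_of_le_ofReal (by positivity) ?_
    have : β Set.univ = (β.map (inner ℝ τ)) Set.univ := by
      rw [Measure.map_apply hcont.measurable MeasurableSet.univ, Set.preimage_univ]
    rw [this]
    refine hβu'.trans ((add_le_add_left hlu _).trans ?_)
    rw [← ENNReal.ofReal_add (by positivity) (by positivity)]
    exact ENNReal.ofReal_le_ofReal (by nlinarith)
  have : IsFiniteMeasure (β.map (inner ℝ τ)) := Measure.isFiniteMeasure_map β _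
  -- from `W` to its projection
  have step2 : |∫ y, f y ∂(H.restrict W) - ∫ s, f (s • τ) ∂(β.map (inner ℝ τ))| ≤ 4 * R * ω := by
    rw [← setIntegral_restrict_eq (μ := H.restrict W) hfP,
      integral_map hcont.measurable.aemeasurable hgm.aestronglyMeasurable]
    have hintf : Integrable f β :=
      Integrable.of_bound hfm.aestronglyMeasurable M (Eventually.of_forall hM)
    have hintg : Integrable (fun y : Plane => f ((inner ℝ τ y : ℝ) • τ)) β :=
      Integrable.of_bound (hf.comp (hcont.smul continuous_const)).aestronglyMeasurable M
        (Eventually.of_forall fun y => hM _)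
    rw [← integral_sub hintf hintg]
    -- Since `0 ∈ W`, flatness puts `W` in a closed cone. That cone is measurable even if `W` is
    -- not, which is enough for an almost-everywhere statement.
    have hcl := (isClosed_setOf_slope_le ε τ).measurableSet
    have hae : ∀ᵐ y ∂β, ‖f y - f ((inner ℝ τ y : ℝ) • τ)‖ ≤ ω := by
      have h1 : ∀ᵐ y ∂β, y ∈ {v : Plane | ‖v - (inner ℝ τ v : ℝ) • τ‖ ≤ ε * |inner ℝ τ v|} := by
        refine ae_restrict_of_ae ?_
        rw [ae_iff]
        change H.restrict W {v : Plane | ‖v - (inner ℝ τ v : ℝ) • τ‖ ≤ ε * |inner ℝ τ v|}ᶜ = 0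
        rw [Measure.restrict_apply hcl.compl]
        convert measure_empty (μ := H)
        refine Set.eq_empty_of_forall_notMem fun y hy => hy.1 ?_
        simpa using hflat y hy.2 0 h0
      filter_upwards [h1, ae_restrict_mem hPm] with y hy hyP
      refine hω _ _ (hy.trans ?_)
      have : |inner ℝ τ y| ≤ R := by simpa [hP, hJ] using hyP
      rw [mul_comm]
      gcongr
    refine (norm_integral_le_of_norm_le_const hae).trans ?_
    rw [mul_comm]
    gcongr
  have step3 : |∫ s, f (s • τ) ∂(β.map (inner ℝ τ)) - ∫ s, f (s • τ) ∂lam| ≤ M * (2 * R * ε) :=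
    abs_integral_sub_integral_le_of_le hlb hgm (fun s => hM _) hM0 (by positivity) hβu'
  have step4 : |(∫ s in J, f (s • τ)) - ∫ s, f (s • τ) ∂lam| ≤ M * η := by
    refine abs_integral_sub_integral_le_of_le hlvol hgm (fun s => hM _) hM0 hη ?_
    rw [Measure.restrict_apply_univ, hJvol, hlam, Measure.restrict_apply_univ,
      Measure.restrict_apply hJm, Set.inter_comm]
    exact hproj
  rw [setIntegral_restrict_eq (μ := volume) hfJ] at step4
  rw [abs_le] at *
  constructor <;> linarith [step1.1, step1.2, step2.1, step2.2, step3.1, step3.2, step4.1, step4.2]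

/-! ### Density points of flat pieces -/

/-- Near `x ∈ W`, the set `Γ` agrees with the `ε`-flat set `W` up to a set of vanishing density, and
the projection of `W` on the line spanned by `τ` has full density at the projection of `x`. -/
structure IsFlatApproxAt (Γ W : Set Plane) (x τ : Plane) (ε : ℝ) : Prop where
  mem : x ∈ W
  norm_eq : ‖τ‖ = 1
  flat : IsFlat ε τ W
  rest : ∀ η : ℝ, 0 < η → ∀ᶠ r in 𝓝[>] (0 : ℝ),
    μH[1] ((Γ \ W) ∩ Metric.closedBall x r) ≤ ENNReal.ofReal (η * r)
  proj : ∀ η : ℝ, 0 < η → ∀ᶠ r in 𝓝[>] (0 : ℝ),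
    ENNReal.ofReal (2 * r) ≤
      volume (inner ℝ τ '' W ∩ Metric.closedBall (inner ℝ τ x) r) + ENNReal.ofReal (η * r)

/-- Besicovitch differentiation for `H¹` on `Γ` gives relative density zero of the complement at
almost every point of `W`; `hup` converts this into `o(r)`. -/
theorem ae_measure_sdiff_inter_closedBall_le {Γ W : Set Plane} (hΓ : MeasurableSet Γ)
    (hfin : μH[1] Γ < ⊤) {A : ℝ} (hA : 0 < A)
    (hup : ∀ x ∈ Γ, ∀ᶠ r in 𝓝[>] (0 : ℝ),
      μH[1] (Metric.closedBall x r ∩ Γ) ≤ ENNReal.ofReal (A * r))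
    (hWΓ : W ⊆ Γ) (hW : NullMeasurableSet W (μH[1] : Measure Plane)) :
    ∀ᵐ x ∂(μH[1] : Measure Plane), x ∈ W → ∀ η : ℝ, 0 < η → ∀ᶠ r in 𝓝[>] (0 : ℝ),
      μH[1] ((Γ \ W) ∩ Metric.closedBall x r) ≤ ENNReal.ofReal (η * r) := by
  set H : Measure Plane := μH[1] with hH
  have : IsFiniteMeasure (H.restrict Γ) := ⟨by rwa [Measure.restrict_apply_univ]⟩
  -- `W` is only null measurable; this hull of its complement differs from it by a null set.
  set V := toMeasurable H Wᶜ with hV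
  have hVm : MeasurableSet V := measurableSet_toMeasurable _ _
  have hWV : Wᶜ ⊆ V := subset_toMeasurable _ _
  have hVW : V =ᵐ[H] Wᶜ := hW.compl.toMeasurable_ae_eq
  have hdens := Besicovitch.ae_tendsto_measure_inter_div_of_measurableSet (H.restrict Γ) hVm
  rw [ae_restrict_iff' hΓ] at hdens
  filter_upwards [hdens, hVW.mem_iff] with x hx hxV hxW η hη
  have hx0 : x ∉ V := fun h => (hxV.1 h) hxW
  have hlim := hx (hWΓ hxW)
  rw [Set.indicator_of_notMem hx0] at hlim
  have hpos : (0 : ENNReal) < ENNReal.ofReal (η / A) := ENNReal.ofReal_pos.2 (by positivity)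
  filter_upwards [(tendsto_order.1 hlim).2 _ hpos, hup x (hWΓ hxW), self_mem_nhdsWithin]
    with r hr hr' hr0
  have hball : MeasurableSet (Metric.closedBall x r) := Metric.isClosed_closedBall.measurableSet
  have h1 := (ENNReal.div_le_iff_le_mul (Or.inr ENNReal.ofReal_ne_top)
    (Or.inl (measure_ne_top _ _))).1 hr.le
  rw [Measure.restrict_apply hball, Measure.restrict_apply (hVm.inter hball)] at h1
  calc H ((Γ \ W) ∩ Metric.closedBall x r) ≤ H (V ∩ Metric.closedBall x r ∩ Γ) :=
        measure_mono fun y hy => ⟨⟨hWV hy.1.2, hy.2⟩, hy.1.1⟩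
    _ ≤ ENNReal.ofReal (η / A) * H (Metric.closedBall x r ∩ Γ) := h1
    _ ≤ ENNReal.ofReal (η / A) * ENNReal.ofReal (A * r) := by gcongr
    _ = ENNReal.ofReal (η * r) := by
        rw [← ENNReal.ofReal_mul (by positivity)]
        congr 1
        field_simp

/-- The shadow has density 1 at almost all of its points, and flatness lifts the exceptional null
set on the line to a null subset of `W`. -/
theorem IsFlat.ae_proj_density {ε : ℝ} {τ : Plane} {W : Set Plane} (h : IsFlat ε τ W)
    (hτ : ‖τ‖ = 1) (hε : 0 ≤ ε) :
    ∀ᵐ x ∂(μH[1] : Measure Plane), x ∈ W → ∀ η : ℝ, 0 < η → ∀ᶠ r in 𝓝[>] (0 : ℝ),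
      ENNReal.ofReal (2 * r) ≤
        volume (inner ℝ τ '' W ∩ Metric.closedBall (inner ℝ τ x) r) + ENNReal.ofReal (η * r) := by
  have hdens := Besicovitch.ae_tendsto_measure_inter_div (volume : Measure ℝ) (inner ℝ τ '' W)
  set N : Set ℝ := {t | ¬ Tendsto (fun r => volume (inner ℝ τ '' W ∩ Metric.closedBall t r) /
    volume (Metric.closedBall t r)) (𝓝[>] 0) (𝓝 1)} with hN
  have hN0 : volume (inner ℝ τ '' W ∩ N) = 0 := by
    rw [Set.inter_comm]
    exact le_antisymm ((Measure.le_restrict_apply _ _).trans_eq hdens) (by simp)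
  have hbad : μH[1] (W ∩ inner ℝ τ ⁻¹' N) = 0 := by
    have := (h.mono (Set.inter_subset_left (t := inner ℝ τ ⁻¹' N))).hausdorffMeasure_le hτ hε
    rw [Set.image_inter_preimage, hN0, mul_zero] at this
    exact le_antisymm this (by simp)
  filter_upwards [measure_eq_zero_iff_ae_notMem.1 hbad] with x hx hxW η hη
  have hlim : Tendsto (fun r => volume (inner ℝ τ '' W ∩ Metric.closedBall (inner ℝ τ x) r) /
      volume (Metric.closedBall (inner ℝ τ x) r)) (𝓝[>] 0) (𝓝 1) := by
    by_contra hcon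
    exact hx ⟨hxW, hcon⟩
  have hlim2 := hlim.add_const (ENNReal.ofReal (η / 2))
  have hlt : (1 : ENNReal) < 1 + ENNReal.ofReal (η / 2) :=
    ENNReal.lt_add_right ENNReal.one_ne_top (ENNReal.ofReal_pos.2 (by positivity)).ne'
  filter_upwards [(tendsto_order.1 hlim2).1 _ hlt, self_mem_nhdsWithin] with r hr hr0
  have hr0' : 0 < r := hr0
  rw [Real.volume_closedBall] at hr
  have hne : ENNReal.ofReal (2 * r) ≠ 0 := (ENNReal.ofReal_pos.2 (by positivity)).ne'
  have h2 := mul_le_mul_left hr.le (ENNReal.ofReal (2 * r))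
  rw [one_mul, add_mul, ENNReal.div_mul_cancel hne ENNReal.ofReal_ne_top,
    ← ENNReal.ofReal_mul (by positivity), show η / 2 * (2 * r) = η * r by ring] at h2
  exact h2

theorem IsRectifiable.ae_exists_isFlatApproxAt {Γ K : Set Plane} (hΓ : MeasurableSet Γ)
    (hfin : μH[1] Γ < ⊤) {A : ℝ} (hA : 0 < A)
    (hup : ∀ x ∈ Γ, ∀ᶠ r in 𝓝[>] (0 : ℝ),
      μH[1] (Metric.closedBall x r ∩ Γ) ≤ ENNReal.ofReal (A * r))
    (hKΓ : K ⊆ Γ) (hK : IsRectifiable K) {ε : ℝ} (hε : 0 < ε) (hε1 : ε ≤ 1) :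
    ∀ᵐ x ∂(μH[1] : Measure Plane), x ∈ K → ∃ W ⊆ K, ∃ τ, IsFlatApproxAt Γ W x τ ε := by
  obtain ⟨S, hS, hcov⟩ := hK.exists_closed_flat_cover hε hε1
  choose hcl τ hτ hflat using hS
  have h1 := fun n => ae_measure_sdiff_inter_closedBall_le hΓ hfin hA hup
    (Set.inter_subset_left.trans hKΓ : K ∩ S n ⊆ Γ) (hK.1.inter (hcl n).measurableSet.nullMeasurableSet)
  have h2 := fun n => ((hflat n).mono (Set.inter_subset_right : K ∩ S n ⊆ S n)).ae_proj_density
    (hτ n) hε.le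
  filter_upwards [ae_all_iff.2 h1, ae_all_iff.2 h2, measure_eq_zero_iff_ae_notMem.1 hcov]
    with x hx1 hx2 hx3 hxK
  have : x ∈ ⋃ n, S n := by
    by_contra hcon
    exact hx3 ⟨hxK, hcon⟩
  obtain ⟨n, hn⟩ := Set.mem_iUnion.1 this
  exact ⟨K ∩ S n, Set.inter_subset_left, τ n, ⟨hxK, hn⟩, hτ n, (hflat n).mono Set.inter_subset_right,
    hx1 n ⟨hxK, hn⟩, hx2 n ⟨hxK, hn⟩⟩

/-! ### Rescaling -/

theorem blowUp_sub (x : Plane) (ρ : ℝ) (y z : Plane) :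
    blowUp x ρ y - blowUp x ρ z = ρ⁻¹ • (y - z) := by
  simp only [blowUp]
  rw [← smul_sub]
  congr 1
  abel

theorem hausdorffMeasure_blowUp_image_le (x : Plane) {ρ : ℝ} (hρ : 0 < ρ) (X : Set Plane) :
    μH[1] (blowUp x ρ '' X) ≤ ENNReal.ofReal ρ⁻¹ * μH[1] X := by
  have hlip : LipschitzWith (Real.toNNReal ρ⁻¹) (blowUp x ρ) := by
    refine LipschitzWith.of_dist_le_mul fun y z => ?_
    rw [dist_eq_norm, blowUp_sub, norm_smul, dist_eq_norm, Real.coe_toNNReal _ (by positivity),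
      Real.norm_of_nonneg (by positivity)]
  simpa [ENNReal.ofReal] using hlip.hausdorffMeasure_image_le zero_le_one X

theorem IsFlat.blowUp_image {ε : ℝ} {τ : Plane} {W : Set Plane} (h : IsFlat ε τ W) (x : Plane)
    (ρ : ℝ) : IsFlat ε τ (blowUp x ρ '' W) := by
  rintro _ ⟨y, hy, rfl⟩ _ ⟨z, hz, rfl⟩
  rw [blowUp_sub, real_inner_smul_right, mul_smul, ← smul_sub, norm_smul, abs_mul, Real.norm_eq_abs]
  have := mul_le_mul_of_nonneg_left (h y hy z hz) (abs_nonneg ρ⁻¹)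
  linarith

theorem tendsto_const_mul_nhdsGT_zero {R : ℝ} (hR : 0 < R) :
    Tendsto (fun r : ℝ => R * r) (𝓝[>] 0) (𝓝[>] 0) := by
  refine tendsto_nhdsWithin_iff.2 ⟨?_, ?_⟩
  · have : Tendsto (fun r : ℝ => R * r) (𝓝 0) (𝓝 (R * 0)) := (continuous_const_mul R).tendsto 0
    rw [mul_zero] at this
    exact this.mono_left nhdsWithin_le_nhds
  · filter_upwards [self_mem_nhdsWithin] with r hr using mul_pos hR hr

theorem mem_blowUp_image_inter_closedBall {x : Plane} {ρ R : ℝ} (hρ : 0 < ρ) {X : Set Plane}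
    {z : Plane} (hz : z ∈ blowUp x ρ '' X ∩ Metric.closedBall 0 R) :
    z ∈ blowUp x ρ '' (X ∩ Metric.closedBall x (R * ρ)) := by
  obtain ⟨⟨y, hy, rfl⟩, hR⟩ := hz
  refine ⟨y, ⟨hy, ?_⟩, rfl⟩
  rw [mem_closedBall_zero_iff, blowUp, norm_smul, Real.norm_of_nonneg (by positivity),
    inv_mul_le_iff₀ hρ] at hR
  rw [mem_closedBall_iff_norm]
  linarith

theorem IsFlatApproxAt.eventually_blowUp {Γ W K : Set Plane} {x τ : Plane} {ε : ℝ}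
    (h : IsFlatApproxAt Γ W x τ ε) (hKΓ : K ⊆ Γ) {R η : ℝ} (hR : 0 < R) (hη : 0 < η) :
    ∀ᶠ ρ in 𝓝[>] (0 : ℝ),
      μH[1] ((blowUp x ρ '' K \ blowUp x ρ '' W) ∩ Metric.closedBall 0 R) ≤ ENNReal.ofReal η ∧
      ENNReal.ofReal (2 * R) ≤
        volume (inner ℝ τ '' (blowUp x ρ '' W) ∩ Metric.closedBall 0 R) + ENNReal.ofReal η := by
  -- Tolerance `η / R` at radius `R * ρ` leaves an error `ρ * η`, which dilation by `ρ⁻¹` turns into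
  -- `η`.
  filter_upwards [(tendsto_const_mul_nhdsGT_zero hR).eventually (h.rest (η / R) (by positivity)),
    (tendsto_const_mul_nhdsGT_zero hR).eventually (h.proj (η / R) (by positivity)),
    self_mem_nhdsWithin] with ρ h1 h2 hρ
  have hρ : 0 < ρ := hρ
  have heq : η / R * (R * ρ) = ρ * η := by field_simp
  rw [heq] at h1 h2
  constructor
  · calc μH[1] ((blowUp x ρ '' K \ blowUp x ρ '' W) ∩ Metric.closedBall 0 R)
        ≤ μH[1] (blowUp x ρ '' ((Γ \ W) ∩ Metric.closedBall x (R * ρ))) := by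
          refine measure_mono fun z hz => mem_blowUp_image_inter_closedBall hρ ⟨?_, hz.2⟩
          obtain ⟨⟨⟨y, hy, rfl⟩, hyW⟩, -⟩ := hz
          exact ⟨y, ⟨hKΓ hy, fun hyW' => hyW ⟨y, hyW', rfl⟩⟩, rfl⟩
      _ ≤ ENNReal.ofReal ρ⁻¹ * ENNReal.ofReal (ρ * η) :=
          (hausdorffMeasure_blowUp_image_le x hρ _).trans (by gcongr)
      _ = ENNReal.ofReal η := by
          rw [← ENNReal.ofReal_mul (by positivity), inv_mul_cancel_left₀ hρ.ne']
  · set t : ℝ := inner ℝ τ x with ht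
    have hlip : LipschitzWith (Real.toNNReal ρ) (fun s : ℝ => t + ρ * s) := by
      refine LipschitzWith.of_dist_le_mul fun y z => ?_
      rw [Real.dist_eq, Real.dist_eq, Real.coe_toNNReal _ hρ.le, add_sub_add_left_eq_sub, ← mul_sub,
        abs_mul, abs_of_pos hρ]
    have hsub : inner ℝ τ '' W ∩ Metric.closedBall t (R * ρ) ⊆
        (fun s : ℝ => t + ρ * s) '' (inner ℝ τ '' (blowUp x ρ '' W) ∩ Metric.closedBall 0 R) := by
      rintro _ ⟨⟨y, hy, rfl⟩, hyR⟩
      have hs : ρ * inner ℝ τ (blowUp x ρ y) = inner ℝ τ y - t := by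
        rw [blowUp, real_inner_smul_right, mul_inv_cancel_left₀ hρ.ne', inner_sub_right]
      refine ⟨inner ℝ τ (blowUp x ρ y), ⟨⟨_, ⟨y, hy, rfl⟩, rfl⟩, ?_⟩, ?_⟩
      · rw [Metric.mem_closedBall, Real.dist_eq, ← hs, abs_mul, abs_of_pos hρ] at hyR
        rw [mem_closedBall_zero_iff, Real.norm_eq_abs]
        nlinarith
      · simp only [hs]; ring
    have hvol : volume (inner ℝ τ '' W ∩ Metric.closedBall t (R * ρ)) ≤ ENNReal.ofReal ρ *
        volume (inner ℝ τ '' (blowUp x ρ '' W) ∩ Metric.closedBall 0 R) := by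
      refine (measure_mono hsub).trans ?_
      simpa [hausdorffMeasure_real, ENNReal.ofReal] using
        hlip.hausdorffMeasure_image_le zero_le_one
          (inner ℝ τ '' (blowUp x ρ '' W) ∩ Metric.closedBall 0 R)
    have h3 := h2.trans (add_le_add_left hvol _)
    rw [ENNReal.ofReal_mul hρ.le, ← mul_add, show 2 * (R * ρ) = ρ * (2 * R) by ring,
      ENNReal.ofReal_mul hρ.le] at h3
    exact (ENNReal.mul_le_mul_iff_right (ENNReal.ofReal_pos.2 hρ).ne' ENNReal.ofReal_ne_top).1 h3

/-! ### Uniqueness of the approximate tangent line -/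

theorem infDist_submodule_eq_norm_mk (T : Submodule ℝ Plane) (v : Plane) :
    Metric.infDist v (T : Set Plane) = ‖(Submodule.Quotient.mk v : Plane ⧸ T)‖ :=
  (QuotientAddGroup.norm_mk (S := T.toAddSubgroup) v).symm

theorem infDist_submodule_smul (T : Submodule ℝ Plane) (a : ℝ) (v : Plane) :
    Metric.infDist (a • v) (T : Set Plane) = |a| * Metric.infDist v (T : Set Plane) := by
  rw [infDist_submodule_eq_norm_mk, infDist_submodule_eq_norm_mk, Submodule.Quotient.mk_smul,
    norm_smul, Real.norm_eq_abs]

/-- The map to the two quotients is injective and linear in finite dimension, hence bounded below.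
If `κ` is its antilipschitz constant, the aperture `1 / (2κ)` forces `‖v‖ ≤ ‖v‖ / 2`. -/
theorem exists_cones_disjoint {T T' : Submodule ℝ Plane} (h : Disjoint T T') :
    ∃ ε : ℝ, 0 < ε ∧ ∀ v : Plane, Metric.infDist v (T : Set Plane) ≤ ε * ‖v‖ →
      Metric.infDist v (T' : Set Plane) ≤ ε * ‖v‖ → v = 0 := by
  have : IsClosed (T : Set Plane) := T.closed_of_finiteDimensional
  have : IsClosed (T' : Set Plane) := T'.closed_of_finiteDimensional
  obtain ⟨κ, hκ, hanti⟩ := LinearMap.exists_antilipschitzWith (T.mkQ.prod T'.mkQ) (by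
    rw [LinearMap.ker_prod, Submodule.ker_mkQ, Submodule.ker_mkQ, h.eq_bot])
  have hκ' : (0 : ℝ) < κ := hκ
  refine ⟨1 / (2 * κ), by positivity, fun v h1 h2 => ?_⟩
  rw [infDist_submodule_eq_norm_mk] at h1 h2
  have h3 := hanti.le_mul_dist v 0
  rw [map_zero, dist_zero_right, dist_zero_right] at h3
  have h4 : ‖(T.mkQ.prod T'.mkQ) v‖ ≤ 1 / (2 * κ) * ‖v‖ := max_le h1 h2
  have h5 : ‖v‖ ≤ ‖v‖ / 2 := calc
    ‖v‖ ≤ κ * (1 / (2 * κ) * ‖v‖) := h3.trans (by gcongr)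
    _ = ‖v‖ / 2 := by field_simp
  have := norm_nonneg v
  exact norm_eq_zero.1 (by linarith)

/-- For two distinct lines, every point of `K` other than `x` lies outside one of two narrow cones.
Both exteriors have density zero, contradicting positive upper density. -/
theorem IsApproxTangentLine.eq {K : Set Plane} {x : Plane} {T T' : Submodule ℝ Plane}
    (h : IsApproxTangentLine K x T) (h' : IsApproxTangentLine K x T') : T = T' := by
  by_contra hne
  have hdis : Disjoint T T' :=
    (Submodule.isAtom_iff_finrank_eq_one.2 h.1).disjoint_of_ne
      (Submodule.isAtom_iff_finrank_eq_one.2 h'.1) hne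
  obtain ⟨ε, hε, hcone⟩ := exists_cones_disjoint hdis
  have hlim := (h.2.2 ε hε).add (h'.2.2 ε hε)
  rw [add_zero] at hlim
  have : NullSingletonClass (μH[1] : Measure Plane) :=
    Measure.nullSingletonClass_hausdorff Plane one_pos
  have hz : Tendsto (fun r : ℝ => μH[1] (Metric.ball x r ∩ K) / ENNReal.ofReal (2 * r)) (𝓝[>] 0)
      (𝓝 0) := by
    refine tendsto_of_tendsto_of_tendsto_of_le_of_le' tendsto_const_nhds hlim
      (Eventually.of_forall fun _ => zero_le) ?_
    filter_upwards [self_mem_nhdsWithin] with r hr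
    have hr : 0 < r := hr
    rw [← ENNReal.add_div]
    refine ENNReal.div_le_div ?_ (ENNReal.ofReal_le_ofReal (by linarith))
    calc μH[1] (Metric.ball x r ∩ K)
        ≤ μH[1] ({x} ∪ ({y ∈ Metric.ball x r ∩ K |
            ε * ‖y - x‖ < Metric.infDist (y - x) (T : Set Plane)} ∪ {y ∈ Metric.ball x r ∩ K |
            ε * ‖y - x‖ < Metric.infDist (y - x) (T' : Set Plane)})) := by
          refine measure_mono fun y hy => ?_
          by_cases h1 : ε * ‖y - x‖ < Metric.infDist (y - x) (T : Set Plane)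
          · exact Or.inr (Or.inl ⟨hy, h1⟩)
          by_cases h2 : ε * ‖y - x‖ < Metric.infDist (y - x) (T' : Set Plane)
          · exact Or.inr (Or.inr ⟨hy, h2⟩)
          exact Or.inl (sub_eq_zero.1 (hcone _ (not_lt.1 h1) (not_lt.1 h2)))
      _ ≤ _ := (measure_union_le _ _).trans (by
          rw [measure_singleton, zero_add]; exact measure_union_le _ _)
  exact h.2.1.ne' hz.limsup_eq

/-! ### The limit direction and its tangent line -/

theorem IsFlatApproxAt.mono_slope {Γ W : Set Plane} {x τ : Plane} {ε ε' : ℝ}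
    (h : IsFlatApproxAt Γ W x τ ε) (hε : ε ≤ ε') : IsFlatApproxAt Γ W x τ ε' :=
  { h with flat := fun y hy z hz =>
      (h.flat y hy z hz).trans (mul_le_mul_of_nonneg_right hε (abs_nonneg _)) }

/-- The set `K ⊆ Γ` contains flat approximations of `Γ` at `x` of arbitrarily small slope, in
directions that converge to `τ`. -/
def HasFlatDirectionAt (Γ K : Set Plane) (x τ : Plane) : Prop :=
  ∀ ε : ℝ, 0 < ε → ∃ W ⊆ K, ∃ τ', ‖τ' - τ‖ ≤ ε ∧ IsFlatApproxAt Γ W x τ' ε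

theorem exists_hasFlatDirectionAt {Γ K : Set Plane} {x : Plane}
    (h : ∀ k : ℕ, ∃ W ⊆ K, ∃ τ, IsFlatApproxAt Γ W x τ (1 / ((k : ℝ) + 1))) :
    ∃ τ, ‖τ‖ = 1 ∧ HasFlatDirectionAt Γ K x τ := by
  choose W hW τ hτ using h
  obtain ⟨τ₀, hτ₀, φ, hφ, hlim⟩ := (isCompact_sphere (0 : Plane) 1).tendsto_subseq
    (fun k => mem_sphere_zero_iff_norm.2 (hτ k).norm_eq)
  refine ⟨τ₀, mem_sphere_zero_iff_norm.1 hτ₀, fun ε hε => ?_⟩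
  have h1 := (tendsto_one_div_add_atTop_nhds_zero_nat (𝕜 := ℝ)).comp hφ.tendsto_atTop
  obtain ⟨n, hn1, hn2⟩ := (((tendsto_order.1 h1).2 ε hε).and
    (Metric.tendsto_nhds.1 hlim ε hε)).exists
  refine ⟨W (φ n), hW _, τ (φ n), ?_, (hτ (φ n)).mono_slope hn1.le⟩
  rw [← dist_eq_norm]
  exact hn2.le

theorem IsFlatApproxAt.upperDensity_pos {Γ W K : Set Plane} {x τ : Plane} {ε a : ℝ} (ha : 0 < a)
    (hlow : ∀ᶠ r in 𝓝[>] (0 : ℝ), ENNReal.ofReal (a * r) ≤ μH[1] (Metric.ball x r ∩ Γ))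
    (h : IsFlatApproxAt Γ W x τ ε) (hWK : W ⊆ K) : 0 < upperDensity K x := by
  -- Of the mass `a * r`, at most half lies off `W`; dividing the rest by `2 * r` gives `a / 4`.
  have hpos : (0 : ENNReal) < ENNReal.ofReal (a / 4) := ENNReal.ofReal_pos.2 (by positivity)
  refine hpos.trans_le (le_limsup_of_frequently_le' (Eventually.frequently ?_))
  filter_upwards [hlow, h.rest (a / 2) (by positivity), self_mem_nhdsWithin] with r h1 h2 hr
  have hr : 0 < r := hr
  have h3 : μH[1] (Metric.ball x r ∩ Γ) ≤
      μH[1] (Metric.ball x r ∩ K) + μH[1] ((Γ \ W) ∩ Metric.closedBall x r) := by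
    refine (measure_mono fun y hy => ?_).trans (measure_union_le _ _)
    by_cases hyW : y ∈ W
    · exact Or.inl ⟨hy.1, hWK hyW⟩
    · exact Or.inr ⟨⟨hy.2, hyW⟩, Metric.ball_subset_closedBall hy.1⟩
  have h4 := h1.trans (h3.trans (add_le_add_right h2 _))
  rw [show a * r = a / 2 * r + a / 2 * r by ring, ENNReal.ofReal_add (by positivity) (by positivity)]
    at h4
  have h5 := (ENNReal.add_le_add_iff_right ENNReal.ofReal_ne_top).1 h4
  rw [ENNReal.le_div_iff_mul_le (Or.inl (ENNReal.ofReal_pos.2 (by positivity)).ne')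
    (Or.inl ENNReal.ofReal_ne_top), ← ENNReal.ofReal_mul (by positivity)]
  convert h5 using 2
  ring

/-- Slope `ε / 2` over `τ'` plus a tilt of at most `ε / 2` keeps `W` inside the `ε`-cone about `τ`,
so the points of `K` outside that cone lie in `Γ \ W`. -/
theorem HasFlatDirectionAt.isApproxTangentLine {Γ K₀ K : Set Plane} {x τ : Plane} {a : ℝ}
    (h : HasFlatDirectionAt Γ K₀ x τ) (hτ : ‖τ‖ = 1) (hK₀ : K₀ ⊆ K) (hKΓ : K ⊆ Γ) (ha : 0 < a)
    (hlow : ∀ᶠ r in 𝓝[>] (0 : ℝ), ENNReal.ofReal (a * r) ≤ μH[1] (Metric.ball x r ∩ Γ)) :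
    IsApproxTangentLine K x (ℝ ∙ τ) := by
  refine ⟨finrank_span_singleton (norm_ne_zero_iff.1 (by rw [hτ]; exact one_ne_zero)), ?_, ?_⟩
  · obtain ⟨W, hW, τ', -, hW'⟩ := h 1 one_pos
    exact hW'.upperDensity_pos ha hlow (hW.trans hK₀)
  intro ε hε
  obtain ⟨W, hW, τ', hττ', hW'⟩ := h (ε / 2) (by positivity)
  rw [ENNReal.tendsto_nhds_zero]
  intro e he
  obtain ⟨η, -, hη, hηe⟩ := ENNReal.lt_iff_exists_real_btwn.1 he
  filter_upwards [hW'.rest η (ENNReal.ofReal_pos.1 hη), self_mem_nhdsWithin] with r h1 hr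
  refine le_trans ?_ hηe.le
  have hr : 0 < r := hr
  refine ENNReal.div_le_of_le_mul ?_
  rw [← ENNReal.ofReal_mul (ENNReal.ofReal_pos.1 hη).le]
  refine (measure_mono ?_).trans h1
  rintro y ⟨⟨hyr, hyK⟩, hy⟩
  refine ⟨⟨hKΓ hyK, fun hyW => absurd hy (not_lt.2 ?_)⟩, Metric.ball_subset_closedBall hyr⟩
  set v := y - x with hv
  set s : ℝ := inner ℝ τ' v with hs
  have hflat : ‖v - s • τ'‖ ≤ ε / 2 * |s| := hW'.flat y hyW x hW'.mem
  have hsv : |s| ≤ ‖v‖ := by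
    simpa [hW'.norm_eq] using abs_real_inner_le_norm τ' v
  calc Metric.infDist v ((ℝ ∙ τ : Submodule ℝ Plane) : Set Plane) ≤ dist v (s • τ) :=
        Metric.infDist_le_dist_of_mem (Submodule.smul_mem _ _ (Submodule.mem_span_singleton_self τ))
    _ = ‖(v - s • τ') + s • (τ' - τ)‖ := by rw [dist_eq_norm, smul_sub]; congr 1; abel
    _ ≤ ε / 2 * |s| + |s| * (ε / 2) := by
        refine (norm_add_le _ _).trans (add_le_add hflat ?_)
        rw [norm_smul, Real.norm_eq_abs]
        gcongr
    _ = ε * |s| := by ring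
    _ ≤ ε * ‖v‖ := by gcongr

/-! ### Weak-* convergence of the blow-ups -/

theorem isometry_smul_unit {τ : Plane} (hτ : ‖τ‖ = 1) : Isometry fun s : ℝ => s • τ :=
  Isometry.of_dist_eq fun s t => by
    rw [dist_eq_norm, ← sub_smul, norm_smul_unit hτ, Real.dist_eq]

theorem setIntegral_span_singleton {τ : Plane} (hτ : ‖τ‖ = 1) (f : Plane → ℝ) :
    ∫ y in ((ℝ ∙ τ : Submodule ℝ Plane) : Set Plane), f y ∂(μH[1] : Measure Plane) =
      ∫ s : ℝ, f (s • τ) := by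
  have hiso := isometry_smul_unit hτ
  have hrange : ((ℝ ∙ τ : Submodule ℝ Plane) : Set Plane) = Set.range fun s : ℝ => s • τ := by
    ext y
    simp [Submodule.mem_span_singleton]
  rw [hrange, ← hiso.map_hausdorffMeasure (Or.inl zero_le_one), hausdorffMeasure_real,
    hiso.isClosedEmbedding.measurableEmbedding.integral_map]

theorem abs_integral_line_sub_le {f : Plane → ℝ} (hf : Continuous f) {R δ ω : ℝ} (hR : 0 ≤ R)
    (hfR : ∀ y, R < ‖y‖ → f y = 0) (hω : ∀ y z, ‖y - z‖ ≤ R * δ → |f y - f z| ≤ ω) {τ τ' : Plane}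
    (hτ : ‖τ‖ = 1) (hτ' : ‖τ'‖ = 1) (h : ‖τ' - τ‖ ≤ δ) :
    |(∫ s : ℝ, f (s • τ')) - ∫ s : ℝ, f (s • τ)| ≤ 2 * R * ω := by
  have hsupp : ∀ σ : Plane, ‖σ‖ = 1 → ∀ s : ℝ, s ∉ Metric.closedBall (0 : ℝ) R → f (s • σ) = 0 :=
    fun σ hσ s hs => hfR _ (by rw [norm_smul_unit hσ]; simpa using hs)
  have hint : ∀ σ : Plane, ‖σ‖ = 1 → Integrable fun s : ℝ => f (s • σ) := fun σ hσ =>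
    (hf.comp (continuous_id.smul continuous_const)).integrable_of_hasCompactSupport
      (HasCompactSupport.intro (isCompact_closedBall (0 : ℝ) R) (hsupp σ hσ))
  rw [← integral_sub (hint τ' hτ') (hint τ hτ),
    ← setIntegral_restrict_eq (B := Metric.closedBall (0 : ℝ) R)
      (fun s hs => by rw [hsupp τ' hτ' s hs, hsupp τ hτ s hs, sub_zero])]
  have hbound : ∀ s ∈ Metric.closedBall (0 : ℝ) R, ‖f (s • τ') - f (s • τ)‖ ≤ ω := fun s hs => by
    refine hω _ _ ?_
    rw [← smul_sub, norm_smul]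
    have : ‖s‖ ≤ R := by simpa using hs
    gcongr
  refine (norm_setIntegral_le_of_norm_le_const measure_closedBall_lt_top hbound).trans_eq ?_
  rw [Measure.real, Real.volume_closedBall, ENNReal.toReal_ofReal (by positivity)]
  ring

theorem HasFlatDirectionAt.blowUpMeasuresTendsto {Γ K₀ K : Set Plane} {x τ : Plane}
    (h : HasFlatDirectionAt Γ K₀ x τ) (hτ : ‖τ‖ = 1) (hK₀ : K₀ ⊆ K) (hKΓ : K ⊆ Γ)
    (hfin : μH[1] Γ < ⊤) : BlowUpMeasuresTendsto K x (ℝ ∙ τ) := by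
  intro f hf hfc
  rw [setIntegral_span_singleton hτ, Metric.tendsto_nhds]
  intro e he
  obtain ⟨M, hM⟩ := hf.bounded_above_of_compact_support hfc
  have hM' : ∀ y, |f y| ≤ M := hM
  have hM0 : 0 ≤ M := (norm_nonneg _).trans (hM 0)
  obtain ⟨R₀, hR₀⟩ := hfc.isCompact.isBounded.subset_closedBall 0
  set R := max R₀ 1 with hRdef
  have hR : 0 < R := lt_max_of_lt_right one_pos
  have hfR : ∀ y, R < ‖y‖ → f y = 0 := fun y hy => image_eq_zero_of_notMem_tsupport fun hy' => by
    have := mem_closedBall_zero_iff.1 (hR₀ hy')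
    linarith [le_max_left R₀ 1]
  -- The choices of `ω`, `ε`, `η` make the total error, including the tilt from `τ'` to `τ`, at most
  -- `3e/4`; `M + 1` guards against `M = 0`.
  set ω := e / (16 * R) with hω
  have hω0 : 0 < ω := by positivity
  obtain ⟨δ, hδ, huc⟩ := Metric.uniformContinuous_iff.1
    (hfc.uniformContinuous_of_continuous hf) ω hω0
  set ε := min 1 (min (δ / (2 * R)) (e / (8 * R * (M + 1)))) with hε
  have hε0 : 0 < ε := by positivity
  have hε1 : ε ≤ 1 := min_le_left _ _
  have hε2 : ε ≤ δ / (2 * R) := (min_le_right _ _).trans (min_le_left _ _)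
  have hε3 : ε ≤ e / (8 * R * (M + 1)) := (min_le_right _ _).trans (min_le_right _ _)
  have hωf : ∀ y z, ‖y - z‖ ≤ R * ε → |f y - f z| ≤ ω := fun y z hyz => by
    refine (huc (?_ : dist y z < δ)).le
    have : R * ε ≤ δ / 2 := calc
      R * ε ≤ R * (δ / (2 * R)) := by gcongr
      _ = δ / 2 := by field_simp
    rw [dist_eq_norm]
    linarith
  set η := e / (16 * (M + 1)) with hη
  have hη0 : 0 < η := by positivity
  have b1 : M * η ≤ e / 16 := calc
    M * η ≤ (M + 1) * η := by gcongr; linarith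
    _ = e / 16 := by rw [hη]; field_simp
  have b2 : M * (R * ε) ≤ e / 8 := calc
    M * (R * ε) ≤ (M + 1) * (R * (e / (8 * R * (M + 1)))) := by gcongr; linarith
    _ = e / 8 := by field_simp
  have b3 : R * ω = e / 16 := by rw [hω]; field_simp
  obtain ⟨W, hW, τ', hττ', hW'⟩ := h ε hε0
  have hline := abs_integral_line_sub_le hf hR.le hfR hωf hτ hW'.norm_eq hττ'
  filter_upwards [hW'.eventually_blowUp hKΓ hR hη0, self_mem_nhdsWithin] with ρ hρ hρ0
  have hρ0 : 0 < ρ := hρ0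
  have hfinK : μH[1] (blowUp x ρ '' K) < ⊤ :=
    (hausdorffMeasure_blowUp_image_le x hρ0 K).trans_lt
      (ENNReal.mul_lt_top ENNReal.ofReal_lt_top ((measure_mono hKΓ).trans_lt hfin))
  have hmain := abs_setIntegral_sub_integral_line_le (Set.image_mono (hW.trans hK₀))
    ⟨x, hW'.mem, by simp [blowUp]⟩ hW'.norm_eq hε0.le hε1 hR.le hη0.le hω0.le
    (hW'.flat.blowUp_image x ρ) hfinK hρ.1 hρ.2 hf hfR hM' hωf
  rw [Real.dist_eq]
  refine (abs_sub_le _ (∫ s : ℝ, f (s • τ')) _).trans_lt ?_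
  have : M * (2 * η + 2 * R * ε) + 4 * R * ω + 2 * R * ω < e := by
    have : M * (2 * η + 2 * R * ε) = 2 * (M * η) + 2 * (M * (R * ε)) := by ring
    nlinarith
  linarith

/-! ### Kuratowski convergence in squares -/

theorem isOpen_square (r : ℝ) (ν x : Plane) : IsOpen (square r ν x) := by
  have h : ∀ σ : Plane, Continuous fun y : Plane => |(inner ℝ σ (y - x) : ℝ)| := fun σ => by
    fun_prop
  exact (isOpen_lt (h ν) continuous_const).inter (isOpen_lt (h (perp ν)) continuous_const)

theorem abs_inner_le_of_mem_closure_square {r : ℝ} {ν x y : Plane} (hy : y ∈ closure (square r ν x)) :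
    |(inner ℝ ν (y - x) : ℝ)| ≤ r ∧ |(inner ℝ (perp ν) (y - x) : ℝ)| ≤ r := by
  have h : ∀ σ : Plane, Continuous fun y : Plane => |(inner ℝ σ (y - x) : ℝ)| := fun σ => by
    fun_prop
  have hcl : IsClosed ({y | |(inner ℝ ν (y - x) : ℝ)| ≤ r} ∩
      {y | |(inner ℝ (perp ν) (y - x) : ℝ)| ≤ r}) :=
    (isClosed_le (h ν) continuous_const).inter (isClosed_le (h (perp ν)) continuous_const)
  have hsub : square r ν x ⊆ {y | |(inner ℝ ν (y - x) : ℝ)| ≤ r} ∩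
      {y | |(inner ℝ (perp ν) (y - x) : ℝ)| ≤ r} := fun z hz => ⟨hz.1.le, hz.2.le⟩
  exact closure_minimal hsub hcl hy

theorem smul_mem_square_of_mem_closure {R θ : ℝ} (hR : 0 < R) (hθ0 : 0 ≤ θ) (hθ1 : θ < 1)
    {ν y : Plane} (hy : y ∈ closure (square R ν 0)) : θ • y ∈ square R ν 0 := by
  have h := abs_inner_le_of_mem_closure_square hy
  have key : ∀ σ : Plane, |(inner ℝ σ (y - 0) : ℝ)| ≤ R → |(inner ℝ σ (θ • y - 0) : ℝ)| < R := by
    intro σ hσ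
    rw [sub_zero] at hσ ⊢
    rw [real_inner_smul_right, abs_mul, abs_of_nonneg hθ0]
    nlinarith [mul_le_mul_of_nonneg_left hσ hθ0]
  exact ⟨key _ h.1, key _ h.2⟩

/-- A tent function supported near `y` has positive integral along the line, hence eventually on the
blow-ups. -/
theorem BlowUpMeasuresTendsto.eventually_nonempty {K : Set Plane} {x τ : Plane} (hτ : ‖τ‖ = 1)
    (h : BlowUpMeasuresTendsto K x (ℝ ∙ τ)) {V : Set Plane} (hV : IsOpen V) {y : Plane}
    (hyV : y ∈ V) (hy : y ∈ (ℝ ∙ τ : Submodule ℝ Plane)) :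
    ∀ᶠ ρ in 𝓝[>] (0 : ℝ), (V ∩ blowUp x ρ '' K).Nonempty := by
  obtain ⟨δ, hδ, hball⟩ := Metric.isOpen_iff.1 hV y hyV
  obtain ⟨s₀, rfl⟩ := Submodule.mem_span_singleton.1 hy
  set f : Plane → ℝ := fun z => max 0 (δ - dist z (s₀ • τ)) with hfdef
  have hf : Continuous f := by fun_prop
  have hfV : ∀ z, z ∉ V → f z = 0 := fun z hz => by
    have : ¬ dist z (s₀ • τ) < δ := fun hlt => hz (hball hlt)
    exact max_eq_left (by linarith)
  have hfs : HasCompactSupport f :=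
    HasCompactSupport.intro (isCompact_closedBall (s₀ • τ) δ) fun z hz => by
      have : ¬ dist z (s₀ • τ) ≤ δ := hz
      exact max_eq_left (by linarith)
  have hlim := h f hf hfs
  rw [setIntegral_span_singleton hτ] at hlim
  have hpos : 0 < ∫ s : ℝ, f (s • τ) := by
    refine Continuous.integral_pos_of_hasCompactSupport_nonneg_nonzero (x := s₀)
      (hf.comp (continuous_id.smul continuous_const))
      (hfs.comp_isClosedEmbedding (isometry_smul_unit hτ).isClosedEmbedding)
      (fun s => le_max_left _ _) ?_
    simp only [hfdef, dist_self, sub_zero]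
    exact (lt_max_of_lt_right hδ).ne'
  filter_upwards [(tendsto_order.1 hlim).1 0 hpos] with ρ hρ
  by_contra hne
  refine hρ.ne' (integral_eq_zero_of_ae ?_)
  change (μH[1] : Measure Plane).restrict (blowUp x ρ '' K) {z | ¬ f z = 0} = 0
  have hm : MeasurableSet {z | ¬ f z = 0} :=
    (isClosed_eq hf continuous_const).measurableSet.compl
  rw [Measure.restrict_apply hm]
  convert measure_empty (μ := (μH[1] : Measure Plane))
  refine Set.eq_empty_of_forall_notMem fun z hz => hne ⟨z, ?_, hz.2⟩
  by_contra hzV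
  exact hz.1 (hfV z hzV)

/-- Points away from the approximate tangent line are not limits of blow-ups, because of the lower
density bound. -/
theorem IsApproxTangentLine.eventually_disjoint_blowUp {Γ : Set Plane} {x : Plane}
    {T : Submodule ℝ Plane} (hT : IsApproxTangentLine Γ x T) {a r₁ : ℝ} (ha : 0 < a) (hr₁ : 0 < r₁)
    (hlow : ∀ w ∈ Γ, ∀ r ∈ Set.Ioo 0 r₁, ENNReal.ofReal (a * r) ≤ μH[1] (Metric.ball w r ∩ Γ))
    {y : Plane} (hy : y ∉ T) :
    ∃ δ > 0, ∀ᶠ ρ in 𝓝[>] (0 : ℝ), ¬ (Metric.ball y δ ∩ blowUp x ρ '' Γ).Nonempty := by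
  have hd : 0 < Metric.infDist y (T : Set Plane) :=
    (T.closed_of_finiteDimensional.notMem_iff_infDist_pos ⟨0, T.zero_mem⟩).1 hy
  set d := Metric.infDist y (T : Set Plane) with hddef
  -- A `δ`-ball about a point within `δ` of `y` stays in the ball of radius `R` about the origin and
  -- farther than `d / 2` from `T`, while `ε * R = d / 4`. It therefore avoids the cone.
  set δ := d / 4 with hδdef
  have hδ : 0 < δ := by positivity
  set R := ‖y‖ + 2 * δ with hRdef
  have hR : 0 < R := by positivity
  set ε := d / (4 * R) with hεdef
  have hε : 0 < ε := by positivity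
  refine ⟨δ, hδ, ?_⟩
  have hlim := (hT.2.2 ε hε).comp (tendsto_const_mul_nhdsGT_zero hR)
  -- Such a ball, scaled back, carries mass at least `a * δ * ρ`, a fraction `a * δ / R` of the
  -- radius `R * ρ`.
  have hpos : (0 : ENNReal) < ENNReal.ofReal (a * δ / R) := ENNReal.ofReal_pos.2 (by positivity)
  filter_upwards [(tendsto_order.1 hlim).2 _ hpos, self_mem_nhdsWithin,
    (tendsto_const_mul_nhdsGT_zero hδ).eventually (Ioo_mem_nhdsGT hr₁)] with ρ h1 hρ hρ1
  have hρ : 0 < ρ := hρ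
  rintro ⟨_, hz, ⟨w, hw, rfl⟩⟩
  have hRρ : ENNReal.ofReal (R * ρ) ≠ 0 := (ENNReal.ofReal_pos.2 (by positivity)).ne'
  have h2 := hlow w hw _ hρ1
  have h3 : Metric.ball w (δ * ρ) ∩ Γ ⊆ {u ∈ Metric.ball x (R * ρ) ∩ Γ |
      ε * ‖u - x‖ < Metric.infDist (u - x) (T : Set Plane)} := by
    rintro u ⟨hu, huΓ⟩
    set v := blowUp x ρ u with hv
    have huv : u - x = ρ • v := by rw [hv, blowUp, smul_inv_smul₀ hρ.ne']
    have hvw : dist v (blowUp x ρ w) < δ := by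
      rw [dist_eq_norm, blowUp_sub, norm_smul, Real.norm_of_nonneg (by positivity),
        inv_mul_lt_iff₀ hρ, ← dist_eq_norm]
      have := Metric.mem_ball.1 hu
      linarith
    have hvy : dist v y < 2 * δ := by
      have h4 := dist_triangle v (blowUp x ρ w) y
      have h5 := Metric.mem_ball.1 hz
      linarith
    have hvR : ‖v‖ < R := by
      have h4 := dist_triangle v y 0
      rw [dist_zero_right, dist_zero_right] at h4
      linarith
    have hvT : d - 2 * δ < Metric.infDist v (T : Set Plane) := by
      have h4 := Metric.infDist_le_infDist_add_dist (s := (T : Set Plane)) (x := y) (y := v)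
      rw [dist_comm] at h4
      linarith
    have hεv : ε * ‖v‖ ≤ d - 2 * δ := calc
      ε * ‖v‖ ≤ ε * R := by gcongr
      _ = d / 4 := by rw [hεdef]; field_simp
      _ ≤ d - 2 * δ := by linarith
    have hnorm : ‖u - x‖ = ρ * ‖v‖ := by rw [huv, norm_smul, Real.norm_of_nonneg hρ.le]
    refine ⟨⟨?_, huΓ⟩, ?_⟩
    · rw [mem_ball_iff_norm, hnorm]
      nlinarith
    · rw [hnorm, huv, infDist_submodule_smul, abs_of_pos hρ]
      nlinarith
  have h4 : ENNReal.ofReal (a * δ / R) ≤ μH[1] {u ∈ Metric.ball x (R * ρ) ∩ Γ |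
      ε * ‖u - x‖ < Metric.infDist (u - x) (T : Set Plane)} / ENNReal.ofReal (R * ρ) := by
    rw [ENNReal.le_div_iff_mul_le (Or.inl hRρ) (Or.inl ENNReal.ofReal_ne_top),
      ← ENNReal.ofReal_mul (by positivity)]
    refine le_trans (le_of_eq ?_) (h2.trans (measure_mono h3))
    congr 1
    field_simp
  exact absurd h1 (not_lt.2 h4)

theorem BlowUpMeasuresTendsto.blowUpsTendstoInSquares {Γ K : Set Plane} {x τ : Plane}
    (hτ : ‖τ‖ = 1) (h : BlowUpMeasuresTendsto K x (ℝ ∙ τ)) (hKΓ : K ⊆ Γ)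
    (hT : IsApproxTangentLine Γ x (ℝ ∙ τ)) {a r₁ : ℝ} (ha : 0 < a) (hr₁ : 0 < r₁)
    (hlow : ∀ w ∈ Γ, ∀ r ∈ Set.Ioo 0 r₁, ENNReal.ofReal (a * r) ≤ μH[1] (Metric.ball w r ∩ Γ)) :
    BlowUpsTendstoInSquares K x (ℝ ∙ τ) := by
  intro ν _ _ R hR
  have hle : kuratowskiLiminf (fun ρ : ℝ => closure (square R ν 0) ∩ blowUp x ρ '' K) (𝓝[>] 0) ⊆
      kuratowskiLimsup (fun ρ : ℝ => closure (square R ν 0) ∩ blowUp x ρ '' K) (𝓝[>] 0) :=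
    fun y hy U hU => (hy U hU).frequently
  have hsup : kuratowskiLimsup (fun ρ : ℝ => closure (square R ν 0) ∩ blowUp x ρ '' K) (𝓝[>] 0) ⊆
      closure (square R ν 0) ∩ ((ℝ ∙ τ : Submodule ℝ Plane) : Set Plane) := by
    intro y hy
    constructor
    · rw [← isClosed_closure.closure_eq]
      refine mem_closure_iff_nhds.2 fun U hU => ?_
      obtain ⟨ρ, z, hzU, hz, -⟩ := (hy U hU).exists
      exact ⟨z, hzU, hz⟩
    · by_contra hyT
      obtain ⟨δ, hδ, hev⟩ := hT.eventually_disjoint_blowUp ha hr₁ hlow hyT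
      obtain ⟨ρ, ⟨z, hzU, -, hz⟩, hne⟩ := ((hy _ (Metric.ball_mem_nhds y hδ)).and_eventually hev).exists
      exact hne ⟨z, hzU, Set.image_mono hKΓ hz⟩
  have hinf : closure (square R ν 0) ∩ ((ℝ ∙ τ : Submodule ℝ Plane) : Set Plane) ⊆
      kuratowskiLiminf (fun ρ : ℝ => closure (square R ν 0) ∩ blowUp x ρ '' K) (𝓝[>] 0) := by
    rintro y ⟨hyS, hyT⟩ U hU
    -- Shrinking `y` slightly along the line moves it from the boundary into the open square, where
    -- the weak-* argument applies.
    have hlim : Tendsto (fun θ : ℝ => θ • y) (𝓝[<] 1) (𝓝 y) := by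
      have : Tendsto (fun θ : ℝ => θ • y) (𝓝 1) (𝓝 ((1 : ℝ) • y)) :=
        (continuous_id.smul continuous_const).tendsto 1
      rw [one_smul] at this
      exact this.mono_left nhdsWithin_le_nhds
    obtain ⟨θ, hθU, hθ⟩ := ((hlim.eventually_mem (interior_mem_nhds.2 hU)).and
      (Ioo_mem_nhdsLT (zero_lt_one (α := ℝ)))).exists
    have hθS := smul_mem_square_of_mem_closure hR hθ.1.le hθ.2 hyS
    have hev := h.eventually_nonempty hτ (isOpen_interior.inter (isOpen_square R ν 0))
      ⟨hθU, hθS⟩ (Submodule.smul_mem _ θ hyT)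
    filter_upwards [hev] with ρ hρ
    obtain ⟨z, ⟨hzU, hzS⟩, hz⟩ := hρ
    exact ⟨z, interior_subset hzU, subset_closure hzS, hz⟩
  exact ⟨(hle.trans hsup).antisymm hinf, hsup.antisymm (hinf.trans hle)⟩

/-! ### Squares and discs; conclusion -/

theorem inner_e₂ (v : Plane) : (inner ℝ e₂ v : ℝ) = v 1 := by
  simp [e₂, PiLp.inner_apply, Fin.sum_univ_two]

theorem inner_perp_e₂ (v : Plane) : (inner ℝ (perp e₂) v : ℝ) = -v 0 := by
  simp [e₂, perp, PiLp.inner_apply, Fin.sum_univ_two]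

theorem norm_sq_eq_add (v : Plane) : ‖v‖ ^ 2 = v 0 ^ 2 + v 1 ^ 2 := by
  rw [EuclideanSpace.norm_sq_eq, Fin.sum_univ_two]
  simp

theorem closedBall_subset_square {x : Plane} {r : ℝ} (hr : 0 < r) :
    Metric.closedBall x r ⊆ square (2 * r) e₂ x := by
  intro y hy
  rw [mem_closedBall_iff_norm] at hy
  have h := norm_sq_eq_add (y - x)
  have h0 := norm_nonneg (y - x)
  have key : ∀ s : ℝ, s ^ 2 ≤ ‖y - x‖ ^ 2 → |s| < 2 * r := fun s hs => by
    have := abs_le_of_sq_le_sq hs h0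
    linarith
  refine ⟨?_, ?_⟩
  · rw [inner_e₂]
    exact key _ (by nlinarith [sq_nonneg ((y - x) 0)])
  · rw [inner_perp_e₂, abs_neg]
    exact key _ (by nlinarith [sq_nonneg ((y - x) 1)])

theorem square_subset_ball {x : Plane} {r : ℝ} (hr : 0 < r) :
    square (r / 2) e₂ x ⊆ Metric.ball x r := by
  rintro y ⟨h1, h2⟩
  rw [inner_e₂] at h1
  rw [inner_perp_e₂, abs_neg] at h2
  rw [mem_ball_iff_norm]
  have h := norm_sq_eq_add (y - x)
  have h3 := sq_lt_sq' (abs_lt.1 h1).1 (abs_lt.1 h1).2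
  have h4 := sq_lt_sq' (abs_lt.1 h2).1 (abs_lt.1 h2).2
  refine lt_of_pow_lt_pow_left₀ 2 hr.le ?_
  nlinarith

end PlanarBlowUp

theorem mainTheorem8 (Γ : Set Plane) (hΓ : MeasurableSet Γ) (hfin : μH[1] Γ < ⊤)
    (r₀ c C : ℝ) (hr₀ : 0 < r₀) (hc : 0 < c) (hC : 0 < C)
    (hdens : ∀ x ∈ Γ, ∀ r ∈ Set.Ioo 0 r₀,
      ENNReal.ofReal c ≤ μH[1] (square r e₂ x ∩ Γ) / ENNReal.ofReal (2 * r) ∧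
        μH[1] (square r e₂ x ∩ Γ) / ENNReal.ofReal (2 * r) ≤ ENNReal.ofReal C) :
    (∀ Γr : Set Plane, IsRectifiablePart Γ Γr →
      ∀ᵐ x ∂(μH[1] : Measure Plane), x ∈ Γr →
        (∃! T : Submodule ℝ Plane, IsApproxTangentLine Γ x T) ∧
        ∀ T : Submodule ℝ Plane, IsApproxTangentLine Γ x T →
          BlowUpsTendstoInSquares Γ x T ∧ BlowUpMeasuresTendsto Γ x T) ∧
    (∀ Γ' : Set Plane, Γ' ⊆ Γ → NullMeasurableSet Γ' μH[1] →
      ∀ Γr' : Set Plane, IsRectifiablePart Γ' Γr' →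
        ∀ᵐ x ∂(μH[1] : Measure Plane), x ∈ Γr' →
          (∃! T : Submodule ℝ Plane, IsApproxTangentLine Γ' x T) ∧
          ∀ T : Submodule ℝ Plane, IsApproxTangentLine Γ' x T →
            IsApproxTangentLine Γ x T ∧
              BlowUpsTendstoInSquares Γ' x T ∧ BlowUpMeasuresTendsto Γ' x T) := by
  have hlow : ∀ w ∈ Γ, ∀ r ∈ Set.Ioo 0 r₀,
      ENNReal.ofReal (c * r) ≤ μH[1] (Metric.ball w r ∩ Γ) := by
    intro w hw r hr
    have hr0 : 0 < r := hr.1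
    have h := (hdens w hw (r / 2) ⟨by linarith, by linarith [hr.2]⟩).1
    have h2r : ENNReal.ofReal (2 * (r / 2)) ≠ 0 := (ENNReal.ofReal_pos.2 (by positivity)).ne'
    rw [ENNReal.le_div_iff_mul_le (Or.inl h2r) (Or.inl ENNReal.ofReal_ne_top),
      ← ENNReal.ofReal_mul hc.le, mul_div_cancel₀ r two_ne_zero] at h
    exact h.trans (measure_mono (Set.inter_subset_inter_left _ (square_subset_ball hr0)))
  have hup : ∀ x ∈ Γ, ∀ᶠ r in 𝓝[>] (0 : ℝ),
      μH[1] (Metric.closedBall x r ∩ Γ) ≤ ENNReal.ofReal (4 * C * r) := by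
    intro x hx
    filter_upwards [Ioo_mem_nhdsGT (half_pos hr₀)] with r hr
    have hr0 : 0 < r := hr.1
    have h := (hdens x hx (2 * r) ⟨by linarith, by linarith [hr.2]⟩).2
    rw [ENNReal.div_le_iff_le_mul (Or.inr ENNReal.ofReal_ne_top) (Or.inl ENNReal.ofReal_ne_top),
      ← ENNReal.ofReal_mul hC.le, show C * (2 * (2 * r)) = 4 * C * r by ring] at h
    exact (measure_mono (Set.inter_subset_inter_left _ (closedBall_subset_square hr0))).trans h
  -- The case `Γ' = Γ` gives the first claim.
  have main : ∀ Γ' ⊆ Γ, ∀ Γr' : Set Plane, IsRectifiablePart Γ' Γr' →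
      ∀ᵐ x ∂(μH[1] : Measure Plane), x ∈ Γr' →
        (∃! T : Submodule ℝ Plane, IsApproxTangentLine Γ' x T) ∧
        ∀ T : Submodule ℝ Plane, IsApproxTangentLine Γ' x T →
          IsApproxTangentLine Γ x T ∧
            BlowUpsTendstoInSquares Γ' x T ∧ BlowUpMeasuresTendsto Γ' x T := by
    intro Γ' hΓ' K hK
    have hflat := fun k : ℕ => hK.2.1.ae_exists_isFlatApproxAt hΓ hfin
      (by positivity : 0 < 4 * C) hup (hK.1.trans hΓ') (ε := 1 / ((k : ℝ) + 1)) (by positivity)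
      (by rw [div_le_one (by positivity)]; linarith [k.cast_nonneg (α := ℝ)])
    filter_upwards [ae_all_iff.2 hflat] with x hx hxK
    obtain ⟨τ, hτ, hdir⟩ := exists_hasFlatDirectionAt fun k => hx k hxK
    have hlowx : ∀ᶠ r in 𝓝[>] (0 : ℝ), ENNReal.ofReal (c * r) ≤ μH[1] (Metric.ball x r ∩ Γ) := by
      filter_upwards [Ioo_mem_nhdsGT hr₀] with r hr using hlow x (hΓ' (hK.1 hxK)) r hr
    -- The same flat pieces lie in `Γ'` and in `Γ`, so one direction is tangent to both.
    have hT := hdir.isApproxTangentLine hτ hK.1 hΓ' hc hlowx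
    have hTΓ := hdir.isApproxTangentLine hτ (hK.1.trans hΓ') subset_rfl hc hlowx
    have hmeas := hdir.blowUpMeasuresTendsto hτ hK.1 hΓ' hfin
    refine ⟨⟨ℝ ∙ τ, hT, fun T hT' => hT'.eq hT⟩, fun T hT' => ?_⟩
    rw [hT'.eq hT]
    exact ⟨hTΓ, hmeas.blowUpsTendstoInSquares hτ hΓ' hTΓ hc hr₀ hlow, hmeas⟩
  refine ⟨fun Γr hΓr => ?_, fun Γ' hΓ' _ => main Γ' hΓ'⟩
  filter_upwards [main Γ subset_rfl Γr hΓr] with x hx hxr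
  exact ⟨(hx hxr).1, fun T hT => ((hx hxr).2 T hT).2⟩
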